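/- Let $\mathring{\mathfrak g}$ be a finite-dimensional simple complex Lie algebra with Cartan subalgebra $\mathring{\mathfrak h}$, set of roots $\mathring\Delta$ and Killing form $\kappa$. Let $$\mathfrak g=\mathring{\mathfrak g}\otimes\mathbb C[t,t^{-1}]\oplus\mathbb C c\oplus\mathbb C d,\qquad \mathfrak h=\mathring{\mathfrak h}\oplus\mathbb Cc\oplus\mathbb Cd,$$ be the associated untwisted affine Kac-Moody algebra: $c$ is central, $[d,x\otimes t^n]=n\,x\otimes t^n$ and $[x\otimes t^m,y\otimes t^n]=[x,y]\otimes t^{m+n}+m\,\delta_{m+n,0}\,\kappa(x,y)\,c$. Let $\Delta\subseteq\mathfrak h^*\setminus\{0\}$ be its set of roots with root spaces $\mathfrak g_\alpha$, let $\delta\in\mathfrak h^*$ be zero on $\mathring{\mathfrak h}\oplus\mathbb Cc$ with $\delta(d)=1$, and let $\Delta^{\mathrm{re}}=\{\alpha+r\delta:\alpha\in\mathring\Delta,\ r\in\mathbb Z\}$ be the set of real roots, where $\mathring\Delta$ is extended by zero to $\mathbb Cc\oplus\mathbb Cd$. For $\alpha\in\Delta^{\mathrm{re}}$ let $\alpha^\vee$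 be the element of $[\mathfrak g_\alpha,\mathfrak g_{-\alpha}]$ with $\alpha(\alpha^\vee)=2$ and $s_\alpha(\beta)=\beta-\beta(\alpha^\vee)\alpha$. A *real closed subroot system* is a non-empty subset $\Psi\subseteq\Delta^{\mathrm{re}}$ such that for all $\alpha,\beta\in\Psi$ we have $s_\alpha(\beta)\in\Psi$, and $\alpha+\beta\in\Psi$ whenever $\alpha+\beta\in\Delta^{\mathrm{re}}$. It is *maximal* if $\Psi\neq\Delta^{\mathrm{re}}$ and $\Psi$ is not properly contained in any other real closed subroot system different from $\Delta^{\mathrm{re}}$. A *regular subalgebra* is an $\mathfrak h$-invariant Lie subalgebra $\mathfrak s\subseteq\mathfrak g$; put $\Delta(\mathfrak s)=\{\alpha\in\Delta:\mathfrak g_\alpha\cap\mathfrak s\neq0\}$ and $\Delta(\mathfrak s)^{\mathrm{re}}=\Delta(\mathfrak s)\cap\Delta^{\mathrm{re}}$. It is *symmetric* if $\Delta(\mathfrak s)=-\Delta(\mathfrak s)$. A proper symmetric regular subalgebra is *maximal* if it is not properly contained in any other proper symmetric regular subalgebra. (1) If $\mathring{\mathfrak g}$ has rank at least $2$, then $\mathfrak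 s\mapsto\Delta(\mathfrak s)^{\mathrm{re}}$ is a bijection from the set of maximal symmetric regular subalgebras of $\mathfrak g$ different from $[\mathfrak g,\mathfrak g]$ onto the set of maximal real closed subroot systems. (2) If $\mathring{\mathfrak g}$ has rank $1$ (type $A_1^{(1)}$), then $\mathfrak s\mapsto\Delta(\mathfrak s)^{\mathrm{re}}$ is a bijection from the set of maximal symmetric regular subalgebras of $\mathfrak g$ different from $[\mathfrak g,\mathfrak g]$ onto the set consisting of the maximal real closed subroot systems and the empty set. -/

import Mathlib

noncomputable section

namespace UntwistedAffine

variable (L : Type*) [LieRing L] [LieAlgebra ℂ L]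

/-- The bracket `[x ⊗ t ^ m, y ⊗ t ^ n] = [x, y] ⊗ t ^ (m + n)` of the loop algebra
`L ⊗ ℂ[t, t⁻¹]`, whose elements `∑ xₙ ⊗ t ^ n` are written as finitely supported functions
`n ↦ xₙ`. -/
def loopLie : (ℤ →₀ L) →ₗ[ℂ] (ℤ →₀ L) →ₗ[ℂ] (ℤ →₀ L) :=
  LinearMap.mk₂ ℂ
    (fun f g ↦ f.sum fun m x ↦ g.sum fun n y ↦ Finsupp.single (m + n) ⁅x, y⁆)
    (fun f f' g ↦ by
      rw [Finsupp.sum_add_index' (by simp)]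
      intro m x x'
      simp only [add_lie, Finsupp.single_add, Finsupp.sum_add])
    (fun a f g ↦ by
      rw [Finsupp.sum_smul_index' (by simp), Finsupp.smul_sum]
      simp only [smul_lie, ← Finsupp.smul_single, Finsupp.smul_sum])
    (fun f g g' ↦ by
      rw [← Finsupp.sum_add]
      congr 1; ext1 m; ext1 x
      rw [Finsupp.sum_add_index' (by simp)]
      intro n y y'
      simp only [lie_add, Finsupp.single_add])
    (fun a f g ↦ by
      rw [Finsupp.smul_sum]
      congr 1; ext1 m; ext1 x
      rw [Finsupp.sum_smul_index' (by simp), Finsupp.smul_sum]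
      simp only [lie_smul, ← Finsupp.smul_single])

/-- The operator `t d/dt` on the loop algebra: `x ⊗ t ^ n ↦ n (x ⊗ t ^ n)`. -/
def degreeOp : (ℤ →₀ L) →ₗ[ℂ] (ℤ →₀ L) :=
  Finsupp.lsum ℂ fun n : ℤ ↦ (n : ℂ) • Finsupp.lsingle n

/-- The `2`-cocycle `(x ⊗ t ^ m, y ⊗ t ^ n) ↦ m δ_{m + n, 0} κ(x, y)` on the loop algebra, where
`κ` is the Killing form. -/
def cocycle : (ℤ →₀ L) →ₗ[ℂ] (ℤ →₀ L) →ₗ[ℂ] ℂ :=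
  Finsupp.lsum ℂ fun m : ℤ ↦
    (m : ℂ) • (killingForm ℂ L).compl₁₂ LinearMap.id (Finsupp.lapply (-m))

variable {L}

theorem loopLie_single (m n : ℤ) (x y : L) :
    loopLie L (Finsupp.single m x) (Finsupp.single n y) = Finsupp.single (m + n) ⁅x, y⁆ := by
  simp [loopLie]

theorem degreeOp_single (n : ℤ) (x : L) :
    degreeOp L (Finsupp.single n x) = (n : ℂ) • Finsupp.single n x := by
  simp [degreeOp]

theorem cocycle_single (m n : ℤ) (x y : L) :
    cocycle L (Finsupp.single m x) (Finsupp.single n y) =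
      if m + n = 0 then (m : ℂ) * killingForm ℂ L x y else 0 := by
  by_cases h : m + n = 0
  · have : n = -m := by omega
    simp [cocycle, this]
  · have : n ≠ -m := by omega
    simp [cocycle, h, this]

theorem degreeOp_lie (f g : ℤ →₀ L) :
    degreeOp L (loopLie L f g) = loopLie L (degreeOp L f) g + loopLie L f (degreeOp L g) := by
  induction f using Finsupp.induction_linear with
  | zero => simp
  | add f f' hf hf' => simp only [map_add, LinearMap.add_apply, hf, hf']; abel
  | single m x =>
    induction g using Finsupp.induction_linear with
    | zero => simp
    | add f f' hf hf' => simp only [map_add, LinearMap.add_apply, hf, hf']; abel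
    | single n y =>
      rw [loopLie_single, degreeOp_single, degreeOp_single, degreeOp_single, map_smul,
        map_smul, LinearMap.smul_apply, loopLie_single, ← add_smul]
      push_cast; rfl

theorem loopLie_skew (f g : ℤ →₀ L) : loopLie L f g = -loopLie L g f := by
  induction f using Finsupp.induction_linear with
  | zero => simp
  | add f f' hf hf' => simp only [map_add, LinearMap.add_apply, hf, hf']; abel
  | single m x =>
    induction g using Finsupp.induction_linear with
    | zero => simp
    | add f f' hf hf' => simp only [map_add, LinearMap.add_apply, hf, hf']; abel
    | single n y =>
      rw [loopLie_single, loopLie_single, add_comm n m, ← Finsupp.single_neg, lie_skew]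

theorem loopLie_self (f : ℤ →₀ L) : loopLie L f f = 0 := by
  have h : (2 : ℂ) • loopLie L f f = 0 := by
    rw [two_smul]; nth_rw 1 [loopLie_skew f f]; exact neg_add_cancel _
  exact (smul_eq_zero.mp h).resolve_left two_ne_zero

theorem loopLie_jacobi (f g h : ℤ →₀ L) :
    loopLie L f (loopLie L g h) = loopLie L (loopLie L f g) h + loopLie L g (loopLie L f h) := by
  induction f using Finsupp.induction_linear with
  | zero => simp
  | add f f' hf hf' => simp only [map_add, LinearMap.add_apply, hf, hf']; abel
  | single a x =>
    induction g using Finsupp.induction_linear with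
    | zero => simp
    | add f f' hf hf' => simp only [map_add, LinearMap.add_apply, hf, hf']; abel
    | single b y =>
      induction h using Finsupp.induction_linear with
      | zero => simp
      | add f f' hf hf' => simp only [map_add, hf, hf']; abel
      | single c z =>
        simp only [loopLie_single]
        rw [leibniz_lie, Finsupp.single_add, ← add_assoc, add_left_comm b a c, add_assoc a b c]

theorem cocycle_skew (f g : ℤ →₀ L) :
    cocycle L f g = -cocycle L g f := by
  induction f using Finsupp.induction_linear with
  | zero => simp
  | add f f' hf hf' => simp only [map_add, LinearMap.add_apply, hf, hf']; ring
  | single m x =>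
    induction g using Finsupp.induction_linear with
    | zero => simp
    | add f f' hf hf' => simp only [map_add, LinearMap.add_apply, hf, hf']; ring
    | single n y =>
      rw [cocycle_single, cocycle_single, add_comm n m]
      split_ifs with h
      · have : n = -m := by omega
        subst this
        rw [LieModule.traceForm_comm ℂ L L x y]; push_cast; ring
      · simp

theorem cocycle_degreeOp (f g : ℤ →₀ L) :
    cocycle L (degreeOp L f) g + cocycle L f (degreeOp L g) = 0 := by
  induction f using Finsupp.induction_linear with
  | zero => simp
  | add f f' hf hf' =>
    simp only [map_add, LinearMap.add_apply]; linear_combination hf + hf'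
  | single m x =>
    induction g using Finsupp.induction_linear with
    | zero => simp
    | add f f' hf hf' =>
      simp only [map_add]; linear_combination hf + hf'
    | single n y =>
      rw [degreeOp_single, degreeOp_single]
      simp only [map_smul, LinearMap.smul_apply, cocycle_single, smul_eq_mul]
      split_ifs with h
      · have : n = -m := by omega
        subst this
        push_cast; ring
      · simp

theorem cocycle_jacobi (f g h : ℤ →₀ L) :
    cocycle L f (loopLie L g h) = cocycle L (loopLie L f g) h + cocycle L g (loopLie L f h) := by
  induction f using Finsupp.induction_linear with
  | zero => simp
  | add f f' hf hf' =>
    simp only [map_add, LinearMap.add_apply]; linear_combination hf + hf'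
  | single a x =>
    induction g using Finsupp.induction_linear with
    | zero => simp
    | add f f' hf hf' =>
      simp only [map_add, LinearMap.add_apply]; linear_combination hf + hf'
    | single b y =>
      induction h using Finsupp.induction_linear with
      | zero => simp
      | add f f' hf hf' =>
        simp only [map_add]; linear_combination hf + hf'
      | single c z =>
        simp only [loopLie_single, cocycle_single]
        have e1 : killingForm ℂ L x ⁅y, z⁆ = killingForm ℂ L ⁅x, y⁆ z :=
          (LieModule.traceForm_apply_lie_apply ℂ L L x y z).symm
        have e2 : killingForm ℂ L y ⁅x, z⁆ = -killingForm ℂ L ⁅x, y⁆ z := by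
          rw [← lie_skew x y, map_neg, LinearMap.neg_apply, neg_neg]
          exact (LieModule.traceForm_apply_lie_apply ℂ L L y x z).symm
        rw [e1, e2]
        by_cases h : a + b + c = 0
        · rw [if_pos (by omega), if_pos h, if_pos (by omega)]; push_cast; ring
        · rw [if_neg (by omega), if_neg h, if_neg (by omega)]; simp

end UntwistedAffine

/-- The untwisted affine Kac-Moody algebra `L ⊗ ℂ[t, t⁻¹] ⊕ ℂ c ⊕ ℂ d` attached to `L`; the element
`f + a c + b d` is the triple `(f, a, b)`. -/
def UntwistedAffine (L : Type*) [LieRing L] [LieAlgebra ℂ L] : Type _ :=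
  (ℤ →₀ L) × ℂ × ℂ

namespace UntwistedAffine

variable {L : Type*} [LieRing L] [LieAlgebra ℂ L]

instance : AddCommGroup (UntwistedAffine L) :=
  inferInstanceAs (AddCommGroup ((ℤ →₀ L) × ℂ × ℂ))

instance : Module ℂ (UntwistedAffine L) :=
  inferInstanceAs (Module ℂ ((ℤ →₀ L) × ℂ × ℂ))

/-- The element `f + a c + b d`. -/
def mk (f : ℤ →₀ L) (a b : ℂ) : UntwistedAffine L := (f, a, b)

/-- The component in the loop algebra. -/
def loop (x : UntwistedAffine L) : (ℤ →₀ L) := x.1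

/-- The coefficient of the central element `c`. -/
def cCoeff (x : UntwistedAffine L) : ℂ := x.2.1

/-- The coefficient of the degree derivation `d`. -/
def dCoeff (x : UntwistedAffine L) : ℂ := x.2.2

@[ext]
theorem ext {x y : UntwistedAffine L} (h1 : x.loop = y.loop) (h2 : x.cCoeff = y.cCoeff)
    (h3 : x.dCoeff = y.dCoeff) : x = y :=
  Prod.ext h1 (Prod.ext h2 h3)

@[simp] theorem loop_mk (f : ℤ →₀ L) (a b : ℂ) : (mk f a b).loop = f := rfl
@[simp] theorem cCoeff_mk (f : ℤ →₀ L) (a b : ℂ) :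
    (mk f a b).cCoeff = a := rfl
@[simp] theorem dCoeff_mk (f : ℤ →₀ L) (a b : ℂ) :
    (mk f a b).dCoeff = b := rfl
@[simp] theorem loop_zero : (0 : UntwistedAffine L).loop = 0 := rfl
@[simp] theorem cCoeff_zero : (0 : UntwistedAffine L).cCoeff = 0 := rfl
@[simp] theorem dCoeff_zero : (0 : UntwistedAffine L).dCoeff = 0 := rfl
@[simp] theorem loop_add (x y : UntwistedAffine L) : (x + y).loop = x.loop + y.loop := rfl
@[simp] theorem cCoeff_add (x y : UntwistedAffine L) :
    (x + y).cCoeff = x.cCoeff + y.cCoeff := rfl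
@[simp] theorem dCoeff_add (x y : UntwistedAffine L) :
    (x + y).dCoeff = x.dCoeff + y.dCoeff := rfl
@[simp] theorem loop_smul (a : ℂ) (x : UntwistedAffine L) : (a • x).loop = a • x.loop := rfl
@[simp] theorem cCoeff_smul (a : ℂ) (x : UntwistedAffine L) :
    (a • x).cCoeff = a * x.cCoeff := rfl
@[simp] theorem dCoeff_smul (a : ℂ) (x : UntwistedAffine L) :
    (a • x).dCoeff = a * x.dCoeff := rfl

/-- The bracket for which `c` is central, `[d, x ⊗ t ^ n] = n (x ⊗ t ^ n)` and
`[x ⊗ t ^ m, y ⊗ t ^ n] = [x, y] ⊗ t ^ (m + n) + m δ_{m + n, 0} κ(x, y) c`. -/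
instance : Bracket (UntwistedAffine L) (UntwistedAffine L) where
  bracket x y := mk
    (loopLie L x.loop y.loop + x.dCoeff • degreeOp L y.loop - y.dCoeff • degreeOp L x.loop)
    (cocycle L x.loop y.loop) 0

@[simp] theorem loop_lie (x y : UntwistedAffine L) : ⁅x, y⁆.loop =
    loopLie L x.loop y.loop + x.dCoeff • degreeOp L y.loop - y.dCoeff • degreeOp L x.loop := rfl
@[simp] theorem cCoeff_lie (x y : UntwistedAffine L) :
    ⁅x, y⁆.cCoeff = cocycle L x.loop y.loop := rfl
@[simp] theorem dCoeff_lie (x y : UntwistedAffine L) : ⁅x, y⁆.dCoeff = 0 := rfl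

instance : LieRing (UntwistedAffine L) where
  add_lie x y z := by
    refine UntwistedAffine.ext ?_ ?_ ?_
    · simp only [loop_lie, loop_add, dCoeff_add, map_add, LinearMap.add_apply, smul_add, add_smul]; abel
    · simp
    · simp
  lie_add x y z := by
    refine UntwistedAffine.ext ?_ ?_ ?_
    · simp only [loop_lie, loop_add, dCoeff_add, map_add, smul_add, add_smul]; abel
    · simp
    · simp
  lie_self x := by
    refine UntwistedAffine.ext ?_ ?_ ?_
    · simp [loopLie_self]
    · simpa [self_eq_neg] using cocycle_skew x.loop x.loop
    · simp
  leibniz_lie x y z := by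
    refine UntwistedAffine.ext ?_ ?_ ?_
    · simp only [loop_lie, loop_add, dCoeff_lie, map_add, map_sub, map_smul, LinearMap.add_apply,
        LinearMap.sub_apply, LinearMap.smul_apply, degreeOp_lie, zero_smul, smul_add, smul_sub,
        loopLie_jacobi x.loop y.loop z.loop]
      rw [loopLie_skew y.loop (degreeOp L x.loop), smul_comm y.dCoeff x.dCoeff,
        smul_comm z.dCoeff x.dCoeff, smul_comm z.dCoeff y.dCoeff]
      simp only [smul_neg]
      abel
    · have h1 := cocycle_degreeOp x.loop y.loop
      have h2 := cocycle_degreeOp x.loop z.loop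
      have h3 := cocycle_degreeOp y.loop z.loop
      have h4 := cocycle_skew y.loop (degreeOp L x.loop)
      simp only [loop_lie, cCoeff_lie, cCoeff_add, map_add, map_sub, map_smul,
        LinearMap.add_apply, LinearMap.sub_apply, LinearMap.smul_apply, smul_eq_mul,
        cocycle_jacobi x.loop y.loop z.loop]
      linear_combination (-z.dCoeff) * h1 + y.dCoeff * h2 - x.dCoeff * h3 + z.dCoeff * h4
    · simp

instance : LieAlgebra ℂ (UntwistedAffine L) where
  lie_smul a x y := by
    refine UntwistedAffine.ext ?_ ?_ ?_
    · simp only [loop_lie, loop_smul, dCoeff_smul, map_smul, smul_sub, smul_add, mul_smul,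
        smul_comm a x.dCoeff]
    · simp
    · simp

variable (H : LieSubalgebra ℂ L)

/-- The Cartan subalgebra `𝔥 = H ⊕ ℂ c ⊕ ℂ d`, presented as the injective linear map
`H × ℂ × ℂ → L ⊗ ℂ[t, t⁻¹] ⊕ ℂ c ⊕ ℂ d`, `(h, a, b) ↦ h ⊗ 1 + a c + b d`. -/
def cartan : (H × ℂ × ℂ) →ₗ[ℂ] UntwistedAffine L where
  toFun t := mk (Finsupp.single 0 (t.1 : L)) t.2.1 t.2.2
  map_add' t t' := UntwistedAffine.ext (by simp) rfl rfl
  map_smul' a t := UntwistedAffine.ext (by simp) rfl rfl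

/-- The dual space of the Cartan subalgebra `𝔥`. -/
abbrev CartanDual : Type _ := Module.Dual ℂ (H × ℂ × ℂ)

/-- The space `𝔤_α` of all `x` with `[t, x] = α(t) x` for all `t ∈ 𝔥`. -/
def rootSpace (α : CartanDual H) : Submodule ℂ (UntwistedAffine L) where
  carrier := {x | ∀ t, ⁅cartan H t, x⁆ = α t • x}
  add_mem' hx hy t := by rw [lie_add, hx t, hy t, smul_add]
  zero_mem' t := by simp
  smul_mem' a x hx t := by rw [lie_smul, hx t, smul_comm]

/-- The set `Δ` of roots: the nonzero functionals on `𝔥` with nonzero root space. -/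
def roots : Set (CartanDual H) := {α | α ≠ 0 ∧ rootSpace H α ≠ ⊥}

/-- The functional `β + r δ`, where `β ∈ H*` is extended by `β(c) = β(d) = 0`, and `δ` vanishes on
`H` and on `c`, with `δ(d) = 1`. -/
def affineWeight (β : Module.Dual ℂ H) (r : ℤ) : CartanDual H :=
  β ∘ₗ LinearMap.fst ℂ H (ℂ × ℂ) +
    (r : ℂ) • (LinearMap.snd ℂ ℂ ℂ ∘ₗ LinearMap.snd ℂ H (ℂ × ℂ))

/-- The real roots of the untwisted affine algebra: `β + r δ` with `β` a root of `L` with respect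
to `H`, and `r ∈ ℤ`. -/
def realRoots [LieRing.IsNilpotent H] : Set (CartanDual H) :=
  {α | ∃ (β : Module.Dual ℂ H) (r : ℤ),
    β ≠ 0 ∧ LieAlgebra.rootSpace H β ≠ ⊥ ∧ α = affineWeight H β r}

/-- `t ∈ 𝔥` is the coroot of `α`: it lies in `[𝔤_α, 𝔤_{-α}]` and `α(t) = 2`. -/
def IsCoroot (α : CartanDual H) (t : H × ℂ × ℂ) : Prop :=
  cartan H t ∈ Submodule.span ℂ
    {z : UntwistedAffine L | ∃ x ∈ rootSpace H α, ∃ y ∈ rootSpace H (-α), ⁅x, y⁆ = z} ∧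
  α t = 2

/-- A nonempty set of roots which is stable under the reflections `β ↦ β - β(α^∨) α` in its real
roots `α`. -/
structure IsSubrootSystem [LieRing.IsNilpotent H] (Ψ : Set (CartanDual H)) : Prop where
  nonempty : Ψ.Nonempty
  subset_roots : Ψ ⊆ roots H
  reflection_mem : ∀ α ∈ Ψ, α ∈ realRoots H → ∀ β ∈ Ψ, ∀ t, IsCoroot H α t → β - β t • α ∈ Ψ

/-- A set of real roots containing the sum of any two of its elements which is a real root. -/
structure IsRealClosed [LieRing.IsNilpotent H] (Ψ : Set (CartanDual H)) : Prop where
  subset_realRoots : Ψ ⊆ realRoots H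
  add_mem : ∀ α ∈ Ψ, ∀ β ∈ Ψ, α + β ∈ realRoots H → α + β ∈ Ψ

/-- A real closed subroot system different from the set of all real roots, which is maximal among
these with respect to inclusion. -/
def IsMaximalRealClosedSubrootSystem [LieRing.IsNilpotent H] (Ψ : Set (CartanDual H)) : Prop :=
  Maximal (fun Φ ↦ IsSubrootSystem H Φ ∧ IsRealClosed H Φ ∧ Φ ≠ realRoots H) Ψ

/-- A Lie subalgebra is regular if it is invariant under the action of `𝔥`. -/
def IsRegular (s : LieSubalgebra ℂ (UntwistedAffine L)) : Prop :=
  ∀ t, ∀ x ∈ s, ⁅cartan H t, x⁆ ∈ s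

/-- The set `Δ(s)` of the roots `α` such that `𝔤_α ∩ s ≠ 0`. -/
def rootsOf (s : LieSubalgebra ℂ (UntwistedAffine L)) : Set (CartanDual H) :=
  {α | α ∈ roots H ∧ rootSpace H α ⊓ s.toSubmodule ≠ ⊥}

/-- The set `Δ(s)^re` of the real roots in `Δ(s)`. -/
def realRootsOf [LieRing.IsNilpotent H] (s : LieSubalgebra ℂ (UntwistedAffine L)) :
    Set (CartanDual H) :=
  realRoots H ∩ rootsOf H s

/-- A regular subalgebra is symmetric if `Δ(s) = -Δ(s)`. -/
def IsSymmetric (s : LieSubalgebra ℂ (UntwistedAffine L)) : Prop :=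
  ∀ α, α ∈ rootsOf H s ↔ -α ∈ rootsOf H s

/-- A proper symmetric regular subalgebra which is not properly contained in any other proper
symmetric regular subalgebra. -/
def IsMaximalSymmetricRegular (s : LieSubalgebra ℂ (UntwistedAffine L)) : Prop :=
  Maximal (fun s' ↦ IsRegular H s' ∧ IsSymmetric H s' ∧ s' ≠ ⊤) s

variable (L) in
/-- The derived algebra `[𝔤, 𝔤]`. -/
def derivedAlgebra : LieSubalgebra ℂ (UntwistedAffine L) :=
  (LieAlgebra.derivedSeries ℂ (UntwistedAffine L) 1).toLieSubalgebra

end UntwistedAffine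

end

set_option linter.unusedSectionVars false

noncomputable section

/-! A maximal symmetric regular `s` different from `[𝔤, 𝔤]` contains `𝔥`: adding `𝔥` to `s` does not
change its roots, and if `s + 𝔥 = 𝔤` then `[𝔤, 𝔤] ⊆ s`, which forces equality because `[𝔤, 𝔤]` is a
hyperplane (`cartan_mem`). So the real roots of `s` form a closed system.

Conversely, a closed system `Ψ` has a largest subalgebra containing `𝔥` with real roots `Ψ`
(`IsClosedSystem.subalgebra`). Beside `𝔥` and the root spaces of `Ψ`, it contains `h ⊗ t ^ r`
exactly when every root `β` with `β h ≠ 0` has `r` as a period, that is, when translation by `r δ`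
preserves the fibre of `Ψ` over `β`. That this is a subalgebra comes down to `isPeriod_add`: a
bracket of opposite root spaces produces a multiple of a coroot, and that coroot lies in the period
space. A maximal `s` is the largest subalgebra attached to its own real roots, whence injectivity.
If `Ψ` is maximal, its largest subalgebra is maximal, whence surjectivity.

The delicate point is that the real roots of a maximal `s` form a maximal system
(`eq_realRootsOf_of_subset`). If they lie in a proper closed `Φ`, the largest subalgebra of `Φ` need
not visibly contain `s`, since `s` may contain imaginary root vectors whose degrees are not periods
of `Φ`. If the gradient of `Φ` omits a root, `Φ` is enlarged to the full preimage of its gradient,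
for which every integer is a period. If it omits none, connectedness of the root system makes a
period in one direction a period in all directions (`isPeriod_of_isPeriod`), and one imaginary root
vector of `s` supplies such a period.

In rank at least two an empty set of real roots is excluded by enlarging it to all translates of
`±α`. In rank one it does occur, for the subalgebra spanned by `H ⊗ ℂ[t, t⁻¹]`, `c` and `d`. -/

theorem Submodule.mem_of_sum_mem_of_eigenvectors {K M I ι : Type*} [Field K] [AddCommGroup M]
    [Module K M] (N : Submodule K M) (T : I → M →ₗ[K] M) (hT : ∀ t, ∀ x ∈ N, T t x ∈ N)
    (F : Finset ι) (χ : ι → I → K) (hχ : Set.InjOn χ F) (x : ι → M)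
    (hx : ∀ i ∈ F, ∀ t, T t (x i) = χ i t • x i) (hsum : ∑ i ∈ F, x i ∈ N) :
    ∀ i ∈ F, x i ∈ N := by
  classical
  induction F using Finset.induction_on generalizing x with
  | empty => simp
  | insert j F hj ih =>
    have key : ∀ i ∈ F, x i ∈ N := by
      intro i hi
      have hne : χ i ≠ χ j := fun h ↦ hj (by
        have := hχ (Finset.mem_coe.2 (Finset.mem_insert_of_mem hi))
          (Finset.mem_coe.2 (Finset.mem_insert_self j F)) h
        rwa [← this])
      obtain ⟨t, ht⟩ := Function.ne_iff.1 hne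
      -- Applying `T t - χ j t` kills the `j`-th term and rescales the others, the `i`-th by a
      -- nonzero factor.
      have h1 : ∑ k ∈ F, (χ k t - χ j t) • x k ∈ N := by
        have h2 := N.sub_mem (hT t _ hsum) (N.smul_mem (χ j t) hsum)
        rw [Finset.sum_insert hj, map_add, smul_add, hx j (Finset.mem_insert_self j F) t,
          add_sub_add_left_eq_sub, map_sum, Finset.smul_sum, ← Finset.sum_sub_distrib] at h2
        rwa [Finset.sum_congr rfl fun k hk ↦ by
          rw [hx k (Finset.mem_insert_of_mem hk) t, ← sub_smul]] at h2
      have h3 := ih (hχ.mono (by simp)) (fun k ↦ (χ k t - χ j t) • x k)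
        (fun k hk t' ↦ by
          rw [map_smul, hx k (Finset.mem_insert_of_mem hk) t', smul_comm]) h1 i hi
      exact (N.smul_mem_iff (sub_ne_zero.2 ht)).1 h3
    intro i hi
    rcases Finset.mem_insert.1 hi with rfl | hi
    · rw [Finset.sum_insert hj] at hsum
      exact (N.add_mem_iff_left (N.sum_mem key)).1 hsum
    · exact key i hi

/-! ### Homogeneous elements of the affine algebra and affine weights -/

namespace UntwistedAffine

variable {L : Type*} [LieRing L] [LieAlgebra ℂ L]

theorem loopLie_single_zero_apply (x : L) (f : ℤ →₀ L) (n : ℤ) :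
    loopLie L (Finsupp.single 0 x) f n = ⁅x, f n⁆ := by
  induction f using Finsupp.induction_linear with
  | zero => simp
  | add f g hf hg => simp [hf, hg]
  | single m y =>
    rw [loopLie_single, zero_add]
    by_cases h : m = n
    · simp [h]
    · simp [Finsupp.single_eq_of_ne' h]

theorem degreeOp_apply (f : ℤ →₀ L) (n : ℤ) : degreeOp L f n = (n : ℂ) • f n := by
  induction f using Finsupp.induction_linear with
  | zero => simp
  | add f g hf hg => simp [hf, hg]
  | single m y =>
    rw [degreeOp_single]
    by_cases h : m = n
    · simp [h]
    · simp [Finsupp.single_eq_of_ne' h]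

theorem cocycle_single_zero (x : L) (f : ℤ →₀ L) : cocycle L (Finsupp.single 0 x) f = 0 := by
  simp [cocycle]

/-- The element `x ⊗ t ^ r`, as a linear function of `x`. -/
def tensor (r : ℤ) : L →ₗ[ℂ] UntwistedAffine L where
  toFun x := mk (Finsupp.single r x) 0 0
  map_add' x y := UntwistedAffine.ext (by simp) (by simp) (by simp)
  map_smul' a x := UntwistedAffine.ext (by simp) (by simp) (by simp)

@[simp] theorem loop_tensor (r : ℤ) (x : L) : (tensor r x).loop = Finsupp.single r x := rfl
@[simp] theorem cCoeff_tensor (r : ℤ) (x : L) : (tensor r x).cCoeff = 0 := rfl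
@[simp] theorem dCoeff_tensor (r : ℤ) (x : L) : (tensor r x).dCoeff = 0 := rfl

theorem tensor_injective (r : ℤ) : Function.Injective (tensor (L := L) r) := fun _ _ h ↦
  Finsupp.single_injective r (congrArg loop h)

theorem tensor_eq_zero_iff (r : ℤ) {x : L} : tensor r x = 0 ↔ x = 0 :=
  map_eq_zero_iff _ (tensor_injective r)

theorem tensor_lie_tensor (r s : ℤ) (x y : L) : ⁅tensor r x, tensor s y⁆ =
    tensor (r + s) ⁅x, y⁆ +
      mk 0 (if r + s = 0 then (r : ℂ) * killingForm ℂ L x y else 0) 0 := by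
  refine UntwistedAffine.ext ?_ ?_ ?_
  · simp [loopLie_single]
  · simp [cocycle_single]
  · simp

theorem tensor_zero_lie_tensor (r : ℤ) (x y : L) :
    ⁅tensor 0 x, tensor r y⁆ = tensor r ⁅x, y⁆ := by
  rw [tensor_lie_tensor, zero_add]
  have : mk (L := L) 0 (if r = 0 then ((0 : ℤ) : ℂ) * killingForm ℂ L x y else 0) 0 = 0 :=
    UntwistedAffine.ext (by simp) (by simp) (by simp)
  rw [this, add_zero]

variable (H : LieSubalgebra ℂ L)

@[simp] theorem loop_cartan (t : H × ℂ × ℂ) :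
    (cartan H t).loop = Finsupp.single 0 (t.1 : L) := rfl
@[simp] theorem cCoeff_cartan (t : H × ℂ × ℂ) : (cartan H t).cCoeff = t.2.1 := rfl
@[simp] theorem dCoeff_cartan (t : H × ℂ × ℂ) : (cartan H t).dCoeff = t.2.2 := rfl

theorem cartan_lie (t : H × ℂ × ℂ) (x : UntwistedAffine L) : ⁅cartan H t, x⁆ =
    mk (loopLie L (Finsupp.single 0 (t.1 : L)) x.loop + t.2.2 • degreeOp L x.loop) 0 0 := by
  refine UntwistedAffine.ext ?_ ?_ ?_
  · simp [degreeOp_single]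
  · simp [cocycle_single_zero]
  · simp

theorem cartan_lie_tensor (t : H × ℂ × ℂ) (r : ℤ) (x : L) :
    ⁅cartan H t, tensor r x⁆ = tensor r (⁅(t.1 : L), x⁆ + (t.2.2 * r) • x) := by
  rw [cartan_lie]
  refine UntwistedAffine.ext ?_ ?_ ?_
  · simp [degreeOp_single, loopLie_single, mul_smul]
  · simp
  · simp

theorem cartan_lie_cartan [IsLieAbelian H] (t u : H × ℂ × ℂ) : ⁅cartan H t, cartan H u⁆ = 0 := by
  rw [cartan_lie]
  refine UntwistedAffine.ext ?_ ?_ ?_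
  · have : ⁅(t.1 : L), (u.1 : L)⁆ = 0 := by
      rw [← LieSubalgebra.coe_bracket, trivial_lie_zero, ZeroMemClass.coe_zero]
    simp [degreeOp_single, loopLie_single, this]
  · simp
  · simp

theorem eq_cartan_add_sum (x : UntwistedAffine L) :
    x = cartan H (0, x.cCoeff, x.dCoeff) + ∑ n ∈ x.loop.support, tensor n (x.loop n) := by
  have h : ∀ F : Finset ℤ, (∑ n ∈ F, tensor n (x.loop n)) =
      mk (∑ n ∈ F, Finsupp.single n (x.loop n)) 0 0 := by
    intro F
    induction F using Finset.cons_induction with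
    | empty => rfl
    | cons j F hj ih =>
      rw [Finset.sum_cons, Finset.sum_cons, ih]
      exact UntwistedAffine.ext (by simp) (by simp) (by simp)
  rw [h]
  refine UntwistedAffine.ext ?_ ?_ ?_
  · simp only [loop_add, loop_cartan, loop_mk, ZeroMemClass.coe_zero, Finsupp.single_zero, zero_add]
    exact (x.loop.sum_single).symm
  · simp
  · simp

theorem affineWeight_apply (β : Module.Dual ℂ H) (r : ℤ) (t : H × ℂ × ℂ) :
    affineWeight H β r t = β t.1 + r * t.2.2 := by
  simp [affineWeight]

theorem affineWeight_add (β γ : Module.Dual ℂ H) (r s : ℤ) :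
    affineWeight H β r + affineWeight H γ s = affineWeight H (β + γ) (r + s) := by
  ext t <;> simp [affineWeight_apply]

theorem affineWeight_neg (β : Module.Dual ℂ H) (r : ℤ) :
    -affineWeight H β r = affineWeight H (-β) (-r) := by
  ext t <;> simp [affineWeight_apply]

theorem affineWeight_sub_zsmul (β γ : Module.Dual ℂ H) (r s k : ℤ) :
    affineWeight H β r - (k : ℂ) • affineWeight H γ s =
      affineWeight H (β - (k : ℂ) • γ) (r - k * s) := by
  ext t <;> simp [affineWeight_apply]

variable {H} in
theorem affineWeight_inj {β γ : Module.Dual ℂ H} {r s : ℤ} :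
    affineWeight H β r = affineWeight H γ s ↔ β = γ ∧ r = s := by
  refine ⟨fun h ↦ ⟨?_, ?_⟩, by rintro ⟨rfl, rfl⟩; rfl⟩
  · ext x
    simpa [affineWeight_apply] using LinearMap.congr_fun h (x, 0, 0)
  · simpa [affineWeight_apply] using LinearMap.congr_fun h (0, 0, 1)

theorem affineWeight_zero : affineWeight H 0 0 = 0 := by
  ext t <;> simp [affineWeight_apply]

end UntwistedAffine

/-! ### Roots of the finite-dimensional algebra -/

namespace UntwistedAffine

open LieAlgebra LieAlgebra.IsKilling LieModule

variable {L : Type*} [LieRing L] [LieAlgebra ℂ L] {H : LieSubalgebra ℂ L}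

variable (H) in
/-- The roots of `L` with respect to `H`. -/
def IsRoot [LieRing.IsNilpotent H] (β : Module.Dual ℂ H) : Prop :=
  β ≠ 0 ∧ LieAlgebra.rootSpace H β ≠ ⊥

theorem mem_realRoots_iff [LieRing.IsNilpotent H] {β : Module.Dual ℂ H} {r : ℤ} :
    affineWeight H β r ∈ realRoots H ↔ IsRoot H β := by
  refine ⟨?_, fun h ↦ ⟨β, r, h.1, h.2, rfl⟩⟩
  rintro ⟨γ, s, h1, h2, h3⟩
  obtain ⟨rfl, rfl⟩ := affineWeight_inj.1 h3
  exact ⟨h1, h2⟩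

namespace IsRoot

/-- A root as a weight of `L`. -/
def weight [LieRing.IsNilpotent H] {β : Module.Dual ℂ H} (h : IsRoot H β) : Weight ℂ H L :=
  ⟨β, h.2⟩

variable [FiniteDimensional ℂ L] [LieAlgebra.IsSimple ℂ L] [H.IsCartanSubalgebra]
  {α β : Module.Dual ℂ H}

theorem weight_apply (h : IsRoot H β) (x : H) : h.weight x = β x := rfl

theorem isNonZero (h : IsRoot H β) : h.weight.IsNonZero := fun h0 ↦ h.1 <| by
  ext x
  exact congrFun h0 x

theorem of_isNonZero {χ : Weight ℂ H L} (h : χ.IsNonZero) : IsRoot H χ.toLinear :=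
  ⟨Weight.coe_toLinear_ne_zero_iff.2 h, χ.genWeightSpace_ne_bot⟩

theorem neg (h : IsRoot H β) : IsRoot H (-β) :=
  ⟨neg_ne_zero.2 h.1, (-h.weight).genWeightSpace_ne_bot⟩

/-- The coroot attached to a root. -/
def coroot (h : IsRoot H β) : H := LieAlgebra.IsKilling.coroot h.weight

theorem apply_coroot (h : IsRoot H β) : β h.coroot = 2 := root_apply_coroot h.isNonZero

theorem coroot_neg (h : IsRoot H β) : h.neg.coroot = -h.coroot :=
  LieAlgebra.IsKilling.coroot_neg h.weight

theorem exists_string (hα : IsRoot H α) (hβ : IsRoot H β) : ∃ p q : ℕ,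
    β hα.coroot = ((p - q : ℤ) : ℂ) ∧
      ∀ n : ℤ, LieAlgebra.rootSpace H ((n : ℂ) • α + β : Module.Dual ℂ H) ≠ ⊥ ↔ n ≤ q ∧ -n ≤ p := by
  refine ⟨chainBotCoeff hα.weight hβ.weight, chainTopCoeff hα.weight hβ.weight,
    apply_coroot_eq_cast hα.weight hβ.weight, fun n ↦ ?_⟩
  rw [← rootSpace_zsmul_add_ne_bot_iff hα.weight hβ.weight hα.isNonZero n]
  have : (⇑((n : ℂ) • α + β : Module.Dual ℂ H) : H → ℂ) = n • ⇑hα.weight + ⇑hβ.weight := by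
    ext x
    simp [weight_apply]
  rw [this]

theorem exists_int_apply_coroot (hα : IsRoot H α) (hβ : IsRoot H β) :
    ∃ p : ℤ, β hα.coroot = p := by
  obtain ⟨p, q, h, -⟩ := hα.exists_string hβ
  exact ⟨_, h⟩

theorem eq_neg_or_eq_of_eq_smul (hα : IsRoot H α) (hβ : IsRoot H β) (k : ℂ) (h : β = k • α) :
    β = -α ∨ β = α := by
  rcases LieAlgebra.IsKilling.eq_neg_or_eq_of_eq_smul hα.weight hβ.weight hβ.isNonZero k
    (by ext x; simp [weight_apply, h]) with h | h
  · left; ext x; exact congrArg (fun w : Weight ℂ H L ↦ w x) h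
  · right; ext x; exact congrArg (fun w : Weight ℂ H L ↦ w x) h

theorem smul_add_ne_zero (hα : IsRoot H α) (hβ : IsRoot H β) (h : β ≠ α) (h' : β ≠ -α) (k : ℂ) :
    k • α + β ≠ 0 := fun h0 ↦ by
  rcases hα.eq_neg_or_eq_of_eq_smul hβ (-k) (by
    rw [neg_smul]; exact (neg_eq_of_add_eq_zero_right h0).symm) with h1 | h1
  · exact h' h1
  · exact h h1

theorem sub_of_pos (hα : IsRoot H α) (hβ : IsRoot H β) (h : β ≠ α) (h' : β ≠ -α) {p : ℤ}
    (hp : β hα.coroot = p) (hpos : 0 < p) : IsRoot H (β - α) := by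
  obtain ⟨a, b, h1, h2⟩ := hα.exists_string hβ
  have h3 : p = a - b := by exact_mod_cast hp.symm.trans h1
  have h4 : ((-1 : ℤ) : ℂ) • α + β = β - α := by simp [sub_eq_add_neg, add_comm]
  rw [← h4]
  exact ⟨hα.smul_add_ne_zero hβ h h' _, (h2 _).2 (by omega)⟩

theorem not_add_self (hα : IsRoot H α) : ¬ IsRoot H (α + α) := fun h ↦ by
  rcases hα.eq_neg_or_eq_of_eq_smul h 2 (two_smul ℂ α).symm with h1 | h1
  · apply hα.1
    have : (3 : ℂ) • α = 0 := by
      rw [show (3 : ℂ) = 1 + 1 + 1 by norm_num, add_smul, add_smul, one_smul, h1,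
        neg_add_cancel]
    exact (smul_eq_zero.1 this).resolve_left (by norm_num)
  · exact hα.1 (by simpa using h1)

theorem exists_mem_ne_zero (hα : IsRoot H α) : ∃ e ∈ LieAlgebra.rootSpace H α, e ≠ 0 :=
  hα.weight.exists_ne_zero

theorem exists_smul_eq (hα : IsRoot H α) {e x : L} (he : e ∈ LieAlgebra.rootSpace H α) (h0 : e ≠ 0)
    (hx : x ∈ LieAlgebra.rootSpace H α) : ∃ c : ℂ, c • e = x := by
  obtain ⟨c, hc⟩ := (finrank_eq_one_iff_of_nonzero' (⟨e, he⟩ : LieAlgebra.rootSpace H α)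
    (by simpa using h0)).1 (finrank_rootSpace_eq_one hα.weight hα.isNonZero) ⟨x, hx⟩
  exact ⟨c, congrArg Subtype.val hc⟩

theorem lie_eq (β : Module.Dual ℂ H) {x : L} (hx : x ∈ LieAlgebra.rootSpace H β) (h : H) :
    ⁅(h : L), x⁆ = β h • x :=
  lie_eq_smul_of_mem_rootSpace hx h

theorem lie_mem {x y : L} (hx : x ∈ LieAlgebra.rootSpace H α)
    (hy : y ∈ LieAlgebra.rootSpace H β) :
    ⁅x, y⁆ ∈ LieAlgebra.rootSpace H (α + β : Module.Dual ℂ H) :=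
  lie_mem_genWeightSpace_of_mem_genWeightSpace hx hy

theorem exists_sl2 (hα : IsRoot H α) : ∃ e f : L, IsSl2Triple (hα.coroot : L) e f ∧
    e ∈ LieAlgebra.rootSpace H α ∧ f ∈ LieAlgebra.rootSpace H (-α : Module.Dual ℂ H) := by
  obtain ⟨h, e, f, ht, he, hf⟩ := exists_isSl2Triple_of_weight_isNonZero hα.isNonZero
  obtain rfl := ht.h_eq_coroot hα.isNonZero he hf
  exact ⟨e, f, ht, he, hf⟩

theorem exists_lie_eq_smul_coroot (hα : IsRoot H α) {e f : L}
    (he : e ∈ LieAlgebra.rootSpace H α) (hf : f ∈ LieAlgebra.rootSpace H (-α : Module.Dual ℂ H)) :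
    ∃ c : ℂ, ⁅e, f⁆ = ((c • hα.coroot : H) : L) := by
  obtain ⟨e', f', ht, he', hf'⟩ := hα.exists_sl2
  obtain ⟨a, rfl⟩ := hα.exists_smul_eq he' ht.e_ne_zero he
  obtain ⟨b, rfl⟩ := hα.neg.exists_smul_eq hf' ht.f_ne_zero hf
  refine ⟨a * b, ?_⟩
  rw [smul_lie, lie_smul, ht.lie_e_f, smul_smul]
  rfl

/-- By `sl₂`-theory: if `m` is a highest vector of the `α`-string through `β`, the root space of `β`
is spanned by `f ^ q m` with `q ≥ 1`, as `α + β` is a root. Writing `q = k + 1` and `N` for the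
length of the string, `e` sends this vector to `(k + 1) (N - k) f ^ k m`, which is nonzero since `k
< q ≤ N`. -/
theorem lie_ne_zero (hα : IsRoot H α) (hβ : IsRoot H β) (hαβ : IsRoot H (α + β)) {x y : L}
    (hx : x ∈ LieAlgebra.rootSpace H α) (hy : y ∈ LieAlgebra.rootSpace H β) (hx0 : x ≠ 0)
    (hy0 : y ≠ 0) : ⁅x, y⁆ ≠ 0 := by
  obtain ⟨e, f, ht, he, hf⟩ := hα.exists_sl2
  set a := hα.weight
  set b := hβ.weight
  obtain ⟨m, hm, hm0⟩ := (chainTop a b).exists_ne_zero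
  have prim : ht.HasPrimitiveVectorWith m (chainLength a b : ℂ) :=
    have h1 : ⁅e, m⁆ ∈ genWeightSpace L (⇑a + ⇑(chainTop a b)) :=
      lie_mem_genWeightSpace_of_mem_genWeightSpace he hm
    ⟨hm0, (chainLength_smul _ _ hm).symm, by
      rwa [genWeightSpace_add_chainTop _ _ hα.isNonZero] at h1⟩
  have hq : 1 ≤ chainTopCoeff a b := by
    have h1 : LieAlgebra.rootSpace H ((1 : ℤ) • ⇑a + ⇑b) ≠ ⊥ := by
      rw [one_smul]; exact hαβ.2
    exact_mod_cast ((rootSpace_zsmul_add_ne_bot_iff a b hα.isNonZero 1).1 h1).1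
  have hle := chainTopCoeff_le_chainLength a b
  obtain ⟨k, hk⟩ := Nat.exists_eq_add_of_le' hq
  have hmem := toEnd_pow_apply_mem hf hm (chainTopCoeff a b)
  have hmem' : (toEnd ℂ L L f ^ chainTopCoeff a b) m ∈ LieAlgebra.rootSpace H β := by
    convert! hmem using 2
    rw [coe_chainTop]
    ext z
    simp [a, b, weight_apply]
  have hne := prim.pow_toEnd_f_ne_zero_of_eq_nat rfl hle
  obtain ⟨c, rfl⟩ := hβ.exists_smul_eq hmem' hne hy
  obtain ⟨d, rfl⟩ := hα.exists_smul_eq he ht.e_ne_zero hx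
  have hc : c ≠ 0 := by rintro rfl; simp at hy0
  have hd : d ≠ 0 := by rintro rfl; simp at hx0
  rw [smul_lie, lie_smul, hk, prim.lie_e_pow_succ_toEnd_f]
  have hne' := prim.pow_toEnd_f_ne_zero_of_eq_nat rfl (show k ≤ chainLength a b by omega)
  refine smul_ne_zero hd (smul_ne_zero hc (smul_ne_zero (mul_ne_zero ?_ ?_) hne'))
  · exact_mod_cast k.succ_ne_zero
  · rw [sub_ne_zero]
    exact_mod_cast (show chainLength a b ≠ k by omega)

theorem exists_apply_ne_zero {h : H} (h0 : h ≠ 0) : ∃ β, IsRoot H β ∧ β h ≠ 0 := by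
  by_contra! hc
  apply h0
  have : h ∈ ⨅ χ : Weight ℂ H L, χ.ker := by
    refine (Submodule.mem_iInf _).2 fun χ ↦ ?_
    by_cases hχ : χ.IsNonZero
    · exact hc _ (of_isNonZero hχ)
    · exact congrFun (not_not.1 hχ) h
  simpa [iInf_ker_weight_eq_bot] using this

/-- Roots satisfying `p` are orthogonal to those that do not, so by irreducibility they span the
dual. A root failing `p` would then vanish on its own coroot. -/
theorem induction_of_connected {p : Module.Dual ℂ H → Prop} (h0 : IsRoot H α) (hp : p α)
    (step : ∀ γ δ (hγ : IsRoot H γ), IsRoot H δ → p γ → δ hγ.coroot ≠ 0 → p δ)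
    (hβ : IsRoot H β) : p β := by
  have mem {γ : Module.Dual ℂ H} (h : IsRoot H γ) : h.weight ∈ H.root := by
    simpa [LieSubalgebra.root] using h.isNonZero
  have hr (i : H.root) : IsRoot H ((rootSystem H).root i) :=
    of_isNonZero (H.isNonZero_coe_root i)
  have hp' (i j : H.root) : (rootSystem H).root i (hr j).coroot = (rootSystem H).pairing i j := rfl
  have hspan := (rootSystem H).span_root_image_eq_top_of_forall_orthogonal
    {i | p ((rootSystem H).root i)} ⟨⟨h0.weight, mem h0⟩, hp⟩ (by
      intro j hj i hi
      by_contra hij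
      refine hj (Submodule.subset_span ⟨j, ?_, rfl⟩)
      refine step _ _ (hr i) (hr j) hi ?_
      rw [hp' j i]
      exact fun h ↦ hij ⟨h, RootPairing.pairing_eq_zero_iff.1 h⟩)
  by_contra hpβ
  have h1 : (⊤ : Submodule ℂ (Module.Dual ℂ H)) ≤
      LinearMap.ker (Module.Dual.eval ℂ H hβ.coroot) := by
    rw [← hspan, Submodule.span_le]
    rintro _ ⟨i, hi, rfl⟩
    by_contra h2
    refine hpβ (step _ _ (hr i) hβ hi ?_)
    intro h3
    apply h2
    exact (RootPairing.pairing_eq_zero_iff (P := rootSystem H) (i := ⟨_, mem hβ⟩) (j := i)).1 h3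
  have h2 : β hβ.coroot = 0 := h1 (Submodule.mem_top (x := β))
  rw [hβ.apply_coroot] at h2
  exact two_ne_zero h2

variable (H) in
theorem exists_isRoot : ∃ β, IsRoot H β := by
  have := RootPairing.IsIrreducible.nontrivial' (P := rootSystem H)
  obtain ⟨h, h0⟩ := exists_ne (0 : H)
  obtain ⟨β, hβ, -⟩ := exists_apply_ne_zero h0
  exact ⟨β, hβ⟩

theorem span_eq_top : Submodule.span ℂ {β | IsRoot H β} = ⊤ := by
  rw [eq_top_iff, ← span_weight_isNonZero_eq_top ℂ L H]
  refine Submodule.span_mono ?_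
  rintro _ ⟨χ, hχ, rfl⟩
  exact of_isNonZero hχ

theorem exists_ne_and_ne_neg (hα : IsRoot H α) (h : 2 ≤ Module.finrank ℂ H) :
    ∃ β, IsRoot H β ∧ β ≠ α ∧ β ≠ -α := by
  by_contra! hc
  have h1 : Submodule.span ℂ {β | IsRoot H β} ≤ Submodule.span ℂ {α} := by
    refine Submodule.span_le.2 fun β hβ ↦ ?_
    by_cases h : β = α
    · exact Submodule.mem_span_singleton.2 ⟨1, by rw [h, one_smul]⟩
    · exact Submodule.mem_span_singleton.2 ⟨-1, by rw [hc β hβ h, neg_one_smul]⟩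
  rw [span_eq_top] at h1
  have h2 := Submodule.finrank_mono h1
  rw [finrank_top, Subspace.dual_finrank_eq] at h2
  have h3 := finrank_span_singleton (K := ℂ) hα.1
  omega

theorem eq_or_eq_neg_of_finrank_eq_one (hα : IsRoot H α) (hβ : IsRoot H β)
    (h : Module.finrank ℂ H = 1) : β = α ∨ β = -α := by
  rw [← Subspace.dual_finrank_eq] at h
  obtain ⟨c, hc⟩ := (finrank_eq_one_iff_of_nonzero' α hα.1).1 h β
  exact (hα.eq_neg_or_eq_of_eq_smul hβ c hc.symm).symm

end IsRoot
end UntwistedAffine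

/-- A nonempty set of integers stable under its point reflections is a coset of a subgroup.
Composing two reflections translates by `2 (a - b)`, so with `g = gcd (x - z) (y - z)` the set is
invariant under `2 g`. Modulo `2 g` the target `x + y - z` is congruent to `y`, `x` or `z`,
according to the parities of `(x - z) / g` and `(y - z) / g`. -/
theorem Int.add_sub_mem_of_two_mul_sub_mem {S : Set ℤ}
    (hS : ∀ x ∈ S, ∀ y ∈ S, 2 * x - y ∈ S) {x y z : ℤ} (hx : x ∈ S) (hy : y ∈ S) (hz : z ∈ S) :
    x + y - z ∈ S := by
  let T : AddSubgroup ℤ :=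
    { carrier := {t | ∀ s, s + t ∈ S ↔ s ∈ S}
      zero_mem' := fun s ↦ by simp
      add_mem' := fun {a b} ha hb s ↦ by rw [← add_assoc, hb, ha]
      neg_mem' := fun {a} ha s ↦ by rw [← ha, neg_add_cancel_right] }
  have hT : ∀ a ∈ S, ∀ b ∈ S, 2 * (a - b) ∈ T := fun a ha b hb s ↦ by
    refine ⟨fun h ↦ ?_, fun h ↦ ?_⟩
    · have := hS b hb _ (hS a ha _ h)
      rwa [show 2 * b - (2 * a - (s + 2 * (a - b))) = s by ring] at this
    · have := hS a ha _ (hS b hb _ h)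
      rwa [show 2 * a - (2 * b - s) = s + 2 * (a - b) by ring] at this
  obtain ⟨g, hg⟩ : ∃ g : ℤ, ((Int.gcd (x - z) (y - z) : ℕ) : ℤ) = g := ⟨_, rfl⟩
  have hgT : 2 * g ∈ T := by
    rw [← hg, Int.gcd_eq_gcd_ab, mul_add, ← mul_assoc, ← mul_assoc, mul_comm _ (Int.gcdA _ _),
      mul_comm _ (Int.gcdB _ _), ← smul_eq_mul, ← smul_eq_mul]
    exact T.add_mem (T.zsmul_mem (hT x hx z hz) _) (T.zsmul_mem (hT y hy z hz) _)
  obtain ⟨a, ha⟩ : g ∣ x - z := hg ▸ Int.gcd_dvd_left ..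
  obtain ⟨b, hb⟩ : g ∣ y - z := hg ▸ Int.gcd_dvd_right ..
  have hmul (k : ℤ) : 2 * g * k ∈ T := by
    rw [mul_comm]; exact T.zsmul_mem hgT k
  rcases Int.even_or_odd' a with ⟨k, rfl | rfl⟩
  · have := (hmul k y).2 hy
    rwa [show y + 2 * g * k = x + y - z by linear_combination -ha] at this
  rcases Int.even_or_odd' b with ⟨l, rfl | rfl⟩
  · have := (hmul l x).2 hx
    rwa [show x + 2 * g * l = x + y - z by linear_combination -hb] at this
  · have := (hmul (k + l + 1) z).2 hz
    rwa [show z + 2 * g * (k + l + 1) = x + y - z by linear_combination -ha - hb] at this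

/-! ### Closed systems of real roots and their periods -/

namespace UntwistedAffine

variable {L : Type*} [LieRing L] [LieAlgebra ℂ L] {H : LieSubalgebra ℂ L}
  [FiniteDimensional ℂ L] [LieAlgebra.IsSimple ℂ L] [H.IsCartanSubalgebra]

/-- A possibly empty set of real roots which is stable under negation, under sums, and under the
reflections in its elements of the same direction. -/
structure IsClosedSystem (Ψ : Set (CartanDual H)) : Prop where
  subset_realRoots : Ψ ⊆ realRoots H
  neg_mem : ∀ χ ∈ Ψ, -χ ∈ Ψ
  add_mem : ∀ χ ∈ Ψ, ∀ η ∈ Ψ, χ + η ∈ realRoots H → χ + η ∈ Ψ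
  two_mul_sub_mem : ∀ α (r s : ℤ), affineWeight H α r ∈ Ψ → affineWeight H α s ∈ Ψ →
    affineWeight H α (2 * r - s) ∈ Ψ

/-- Translation by `r δ` preserves the elements of `Ψ` of the form `β + s δ`. -/
def IsPeriod (Ψ : Set (CartanDual H)) (β : Module.Dual ℂ H) (r : ℤ) : Prop :=
  ∀ s, affineWeight H β s ∈ Ψ → affineWeight H β (s + r) ∈ Ψ

namespace IsClosedSystem

variable {Ψ : Set (CartanDual H)} {α β : Module.Dual ℂ H} {r s : ℤ}

theorem isRoot (h : IsClosedSystem Ψ) (hα : affineWeight H α r ∈ Ψ) : IsRoot H α :=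
  mem_realRoots_iff.1 (h.subset_realRoots hα)

theorem affineWeight_neg_mem (h : IsClosedSystem Ψ) (hα : affineWeight H α r ∈ Ψ) :
    affineWeight H (-α) (-r) ∈ Ψ := by
  rw [← affineWeight_neg]; exact h.neg_mem _ hα

theorem affineWeight_add_mem (h : IsClosedSystem Ψ) (hα : affineWeight H α r ∈ Ψ)
    (hβ : affineWeight H β s ∈ Ψ) (hαβ : IsRoot H (α + β)) :
    affineWeight H (α + β) (r + s) ∈ Ψ := by
  rw [← affineWeight_add]
  exact h.add_mem _ hα _ hβ (by rw [affineWeight_add]; exact mem_realRoots_iff.2 hαβ)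

theorem affineWeight_sub_mem (h : IsClosedSystem Ψ) (hα : affineWeight H α r ∈ Ψ)
    (hβ : affineWeight H β s ∈ Ψ) (hαβ : IsRoot H (α - β)) :
    affineWeight H (α - β) (r - s) ∈ Ψ := by
  rw [sub_eq_add_neg] at hαβ
  rw [sub_eq_add_neg, sub_eq_add_neg]
  exact h.affineWeight_add_mem hα (h.affineWeight_neg_mem hβ) hαβ

theorem add_sub_mem (h : IsClosedSystem Ψ) {x y z : ℤ} (hx : affineWeight H α x ∈ Ψ)
    (hy : affineWeight H α y ∈ Ψ) (hz : affineWeight H α z ∈ Ψ) :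
    affineWeight H α (x + y - z) ∈ Ψ :=
  Int.add_sub_mem_of_two_mul_sub_mem (S := {x | affineWeight H α x ∈ Ψ})
    (fun _ hx _ hy ↦ h.two_mul_sub_mem α _ _ hx hy) hx hy hz

theorem isPeriod_of_mem (h : IsClosedSystem Ψ) (hs : affineWeight H α s ∈ Ψ)
    (hr : affineWeight H α (s + r) ∈ Ψ) : IsPeriod Ψ α r := fun t ht ↦ by
  have := h.add_sub_mem ht hr hs
  rwa [show t + (s + r) - s = t + r by ring] at this

theorem isPeriod_neg_right (h : IsClosedSystem Ψ) (hr : IsPeriod Ψ α r) : IsPeriod Ψ α (-r) :=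
  fun t ht ↦ h.isPeriod_of_mem (hr t ht) (by rwa [add_neg_cancel_right]) t ht

theorem isPeriod_neg_left (h : IsClosedSystem Ψ) (hr : IsPeriod Ψ α r) : IsPeriod Ψ (-α) r :=
  fun t ht ↦ by
    have h1 := h.affineWeight_neg_mem ht
    rw [neg_neg] at h1
    have h2 := h.affineWeight_neg_mem (h.isPeriod_neg_right hr _ h1)
    rwa [neg_add, neg_neg, neg_neg] at h2

/-- Positivity makes `β - α` a root, so one may go from `β` to `β - α` by adding `-α + s δ` and
return by adding `α + r δ`. The round trip shifts by `r + s`. -/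
theorem isPeriod_of_pos (h : IsClosedSystem Ψ) (hα : affineWeight H α r ∈ Ψ)
    (hα' : affineWeight H (-α) s ∈ Ψ) (hβ : IsRoot H β) (h1 : β ≠ α) (h2 : β ≠ -α) {p : ℤ}
    (hp : β (h.isRoot hα).coroot = p) (hpos : 0 < p) : IsPeriod Ψ β (r + s) := fun t ht ↦ by
  have h3 := (h.isRoot hα).sub_of_pos hβ h1 h2 hp hpos
  rw [sub_eq_add_neg] at h3
  have h4 := h.affineWeight_add_mem ht hα' h3
  have h5 := h.affineWeight_add_mem h4 hα (by rwa [neg_add_cancel_right])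
  rwa [neg_add_cancel_right, add_assoc, add_comm s r] at h5

/-- This is the combinatorial trace of the bracket of the two root spaces, which yields the coroot
of `α` in degree `r + s`. It is what puts that coroot in the period space. A negative pairing is
reduced to a positive one by exchanging `α` and `-α`. -/
theorem isPeriod_add (h : IsClosedSystem Ψ) (hα : affineWeight H α r ∈ Ψ)
    (hα' : affineWeight H (-α) s ∈ Ψ) (hβ : IsRoot H β) (h0 : β (h.isRoot hα).coroot ≠ 0) :
    IsPeriod Ψ β (r + s) := by
  have hself : IsPeriod Ψ α (r + s) := by
    have h1 := h.affineWeight_neg_mem hα'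
    rw [neg_neg] at h1
    exact h.isPeriod_of_mem h1 (by rwa [add_comm r, neg_add_cancel_left])
  by_cases h1 : β = α
  · rwa [h1]
  by_cases h2 : β = -α
  · rw [h2]; exact h.isPeriod_neg_left hself
  obtain ⟨p, hp⟩ := (h.isRoot hα).exists_int_apply_coroot hβ
  rcases lt_trichotomy p 0 with hn | rfl | hpos
  · rw [add_comm]
    refine h.isPeriod_of_pos hα' (by rwa [neg_neg]) hβ h2 (by rwa [neg_neg]) (p := -p) ?_
      (by omega)
    have := (h.isRoot hα).coroot_neg
    rw [this, map_neg, hp, Int.cast_neg]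
  · exact absurd (by simpa using hp) h0
  · exact h.isPeriod_of_pos hα hα' hβ h1 h2 hp hpos

/-- If `γ + t δ` lies in `Ψ` and `r` is a period of `γ`, then `γ + (t + r) δ` and `-γ - t δ` both
lie in `Ψ`, so `r` is a period of every root not orthogonal to `γ`. Since all fibres are nonempty,
this spreads along the connected root system. -/
theorem isPeriod_of_isPeriod (h : IsClosedSystem Ψ) (hR : ∀ β, IsRoot H β →
    ∃ t, affineWeight H β t ∈ Ψ) (hα : IsRoot H α) (hr : IsPeriod Ψ α r) (hβ : IsRoot H β) :
    IsPeriod Ψ β r := by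
  refine IsRoot.induction_of_connected (p := fun γ ↦ IsPeriod Ψ γ r) hα hr ?_ hβ
  intro γ δ hγ hδ hp h0
  obtain ⟨t, ht⟩ := hR γ hγ
  have := h.isPeriod_add (hp t ht) (h.affineWeight_neg_mem ht) hδ h0
  rwa [add_neg_cancel_comm] at this

theorem reflection_mem_of_nonneg (h : IsClosedSystem Ψ) (hα : affineWeight H α r ∈ Ψ)
    (hβ : affineWeight H β s ∈ Ψ) {p : ℤ} (hp : β (h.isRoot hα).coroot = p) (hpos : 0 ≤ p) :
    affineWeight H (β - (p : ℂ) • α) (s - p * r) ∈ Ψ := by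
  have hα0 := h.isRoot hα
  have hβ0 := h.isRoot hβ
  by_cases h1 : β = α
  · subst h1
    rw [IsRoot.apply_coroot] at hp
    obtain rfl : p = 2 := by exact_mod_cast hp.symm
    have := h.affineWeight_neg_mem (h.two_mul_sub_mem _ _ _ hα hβ)
    convert! this using 2
    · rw [Int.cast_ofNat, two_smul]; abel
    · ring
  by_cases h2 : β = -α
  · subst h2
    rw [LinearMap.neg_apply, IsRoot.apply_coroot] at hp
    obtain rfl : p = -2 := by exact_mod_cast hp.symm
    omega
  obtain ⟨a, b, h3, h4⟩ := hα0.exists_string hβ0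
  have h5 : p = a - b := by exact_mod_cast hp.symm.trans h3
  -- Since `k ≤ p = a - b ≤ a`, each `β - k α` stays in the `α`-string, so `α + r δ` can be
  -- subtracted one step at a time by closedness alone.
  have key : ∀ k : ℕ, k ≤ p → affineWeight H (β - ((k : ℤ) : ℂ) • α) (s - k * r) ∈ Ψ := by
    intro k
    induction k with
    | zero => intro _; simpa using hβ
    | succ k ih =>
      intro hk
      have h6 : β - (((k + 1 : ℕ) : ℤ) : ℂ) • α = β - ((k : ℤ) : ℂ) • α - α := by
        push_cast; rw [add_smul, one_smul, sub_sub]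
      have h7 : s - ((k + 1 : ℕ) : ℤ) * r = s - k * r - r := by push_cast; ring
      have h8 : β - (((k + 1 : ℕ) : ℤ) : ℂ) • α = ((-(k + 1 : ℕ) : ℤ) : ℂ) • α + β := by
        push_cast; rw [neg_smul]; abel
      have h9 : IsRoot H (β - (((k + 1 : ℕ) : ℤ) : ℂ) • α) := by
        rw [h8]
        exact ⟨hα0.smul_add_ne_zero hβ0 h1 h2 _, (h4 _).2 (by omega)⟩
      rw [h6] at h9 ⊢
      rw [h7]
      exact h.affineWeight_sub_mem (ih (by omega)) hα h9
  lift p to ℕ using hpos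
  exact key p le_rfl

theorem reflection_mem (h : IsClosedSystem Ψ) (hα : affineWeight H α r ∈ Ψ)
    (hβ : affineWeight H β s ∈ Ψ) {p : ℤ} (hp : β (h.isRoot hα).coroot = p) :
    affineWeight H (β - (p : ℂ) • α) (s - p * r) ∈ Ψ := by
  rcases le_total 0 p with h0 | h0
  · exact h.reflection_mem_of_nonneg hα hβ hp h0
  · have h1 := h.reflection_mem_of_nonneg (h.affineWeight_neg_mem hα) hβ (p := -p) (by
      have := (h.isRoot hα).coroot_neg
      rw [this, map_neg, hp, Int.cast_neg]) (by omega)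
    simpa using h1

end IsClosedSystem

/-! ### Full preimages of finite systems, and gradients -/

/-- The real roots `β + r δ` with `β ∈ R` and `r` arbitrary. -/
def translates (R : Set (Module.Dual ℂ H)) : Set (CartanDual H) :=
  {χ | ∃ β ∈ R, ∃ r, χ = affineWeight H β r}

theorem affineWeight_mem_translates {R : Set (Module.Dual ℂ H)} {β : Module.Dual ℂ H} {r : ℤ} :
    affineWeight H β r ∈ translates R ↔ β ∈ R := by
  refine ⟨?_, fun h ↦ ⟨β, h, r, rfl⟩⟩
  rintro ⟨γ, hγ, s, h⟩
  rwa [(affineWeight_inj.1 h).1]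

theorem isPeriod_translates (R : Set (Module.Dual ℂ H)) (β : Module.Dual ℂ H) (r : ℤ) :
    IsPeriod (translates R) β r :=
  fun _ h ↦ affineWeight_mem_translates.2 (affineWeight_mem_translates.1 h)

theorem isClosedSystem_translates {R : Set (Module.Dual ℂ H)} (hR : ∀ β ∈ R, IsRoot H β)
    (hneg : ∀ β ∈ R, -β ∈ R) (hadd : ∀ β ∈ R, ∀ γ ∈ R, IsRoot H (β + γ) → β + γ ∈ R) :
    IsClosedSystem (translates R) where
  subset_realRoots := by
    rintro _ ⟨β, hβ, r, rfl⟩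
    exact mem_realRoots_iff.2 (hR β hβ)
  neg_mem := by
    rintro _ ⟨β, hβ, r, rfl⟩
    rw [affineWeight_neg]
    exact affineWeight_mem_translates.2 (hneg β hβ)
  add_mem := by
    rintro _ ⟨β, hβ, r, rfl⟩ _ ⟨γ, hγ, s, rfl⟩ h
    rw [affineWeight_add] at h ⊢
    exact affineWeight_mem_translates.2 (hadd β hβ γ hγ (mem_realRoots_iff.1 h))
  two_mul_sub_mem α r s h _ :=
    affineWeight_mem_translates.2 (affineWeight_mem_translates.1 h)

theorem isClosedSystem_translates_pair {α : Module.Dual ℂ H} (hα : IsRoot H α) :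
    IsClosedSystem (translates {α, -α}) := by
  refine isClosedSystem_translates ?_ ?_ ?_
  · rintro _ (rfl | rfl)
    exacts [hα, hα.neg]
  · rintro _ (rfl | rfl)
    · simp
    · simp
  · rintro _ (rfl | rfl) _ (rfl | rfl) h
    · exact absurd h hα.not_add_self
    · exact absurd (add_neg_cancel _) h.1
    · exact absurd (neg_add_cancel _) h.1
    · exact absurd h hα.neg.not_add_self

/-- The set of the `β` such that `β + r δ` lies in `Ψ` for some `r`. -/
def gradient (Ψ : Set (CartanDual H)) : Set (Module.Dual ℂ H) := {β | ∃ r, affineWeight H β r ∈ Ψ}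

namespace IsClosedSystem

variable {Ψ : Set (CartanDual H)}

theorem translates_gradient (h : IsClosedSystem Ψ) :
    IsClosedSystem (translates (gradient Ψ)) := by
  refine isClosedSystem_translates ?_ ?_ ?_
  · rintro β ⟨r, hr⟩
    exact h.isRoot hr
  · rintro β ⟨r, hr⟩
    exact ⟨-r, h.affineWeight_neg_mem hr⟩
  · rintro β ⟨r, hr⟩ γ ⟨s, hs⟩ h1
    exact ⟨r + s, h.affineWeight_add_mem hr hs h1⟩

theorem subset_translates_gradient (h : IsClosedSystem Ψ) : Ψ ⊆ translates (gradient Ψ) := by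
  intro χ hχ
  obtain ⟨β, r, -, -, rfl⟩ := h.subset_realRoots hχ
  exact affineWeight_mem_translates.2 ⟨r, hχ⟩

end IsClosedSystem

theorem translates_ne_realRoots {R : Set (Module.Dual ℂ H)} {β : Module.Dual ℂ H}
    (hβ : IsRoot H β) (h : β ∉ R) : translates R ≠ realRoots H := fun h1 ↦
  h (affineWeight_mem_translates.1 (h1 ▸ mem_realRoots_iff.2 hβ : affineWeight H β 0 ∈ _))

theorem isClosedSystem_empty : IsClosedSystem (∅ : Set (CartanDual H)) := by
  constructor <;> simp

/-! ### Root spaces and coroots of the affine algebra -/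

theorem tensor_mem_rootSpace {β : Module.Dual ℂ H} (r : ℤ) {e : L}
    (he : e ∈ LieAlgebra.rootSpace H β) : tensor r e ∈ rootSpace H (affineWeight H β r) := by
  intro t
  rw [cartan_lie_tensor, IsRoot.lie_eq β he, ← add_smul, map_smul, affineWeight_apply,
    mul_comm t.2.2]

theorem mem_rootSpace_zero_iff {e : L} :
    e ∈ LieAlgebra.rootSpace H (0 : Module.Dual ℂ H) ↔ e ∈ H := by
  have : (⇑(0 : Module.Dual ℂ H) : H → ℂ) = 0 := rfl
  rw [this, LieAlgebra.rootSpace_zero_eq]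
  rfl

/-- A weight vector of nonzero weight has no `c` or `d` component, because brackets with `𝔥` have
none. Its eigenvalue under `d` then singles out one degree. -/
theorem exists_eq_tensor {χ : CartanDual H} (hχ : χ ≠ 0) {x : UntwistedAffine L}
    (hx : x ∈ rootSpace H χ) (hx0 : x ≠ 0) : ∃ (β : Module.Dual ℂ H) (r : ℤ) (e : L),
      χ = affineWeight H β r ∧ x = tensor r e ∧ e ∈ LieAlgebra.rootSpace H β ∧ e ≠ 0 := by
  have hx' (t : H × ℂ × ℂ) :
      mk (loopLie L (Finsupp.single 0 (t.1 : L)) x.loop + t.2.2 • degreeOp L x.loop) 0 0 =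
        χ t • x := by
    rw [← cartan_lie]; exact hx t
  have hloop (t : H × ℂ × ℂ) (n : ℤ) :
      ⁅(t.1 : L), x.loop n⁆ + (t.2.2 * n) • x.loop n = χ t • x.loop n := by
    have := DFunLike.congr_fun (congrArg loop (hx' t)) n
    simpa [loopLie_single_zero_apply, degreeOp_apply, mul_smul] using this
  obtain ⟨t, ht⟩ : ∃ t, χ t ≠ 0 := by
    by_contra! h
    exact hχ (LinearMap.ext h)
  have hc : x.cCoeff = 0 := by
    have := congrArg cCoeff (hx' t)
    simpa [ht] using this
  have hd : x.dCoeff = 0 := by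
    have := congrArg dCoeff (hx' t)
    simpa [ht] using this
  obtain ⟨r, hr⟩ : ∃ r, x.loop r ≠ 0 := by
    by_contra! h
    exact hx0 (UntwistedAffine.ext (Finsupp.ext h) hc hd)
  have hχd (a b : ℂ) : χ (0, a, b) = r * b := by
    have := hloop (0, a, b) r
    simp only [ZeroMemClass.coe_zero, zero_lie, zero_add] at this
    rw [← smul_left_injective ℂ hr this, mul_comm]
  refine ⟨χ ∘ₗ LinearMap.inl ℂ H (ℂ × ℂ), r, x.loop r, ?_, ?_, ?_, hr⟩
  · refine LinearMap.ext fun u ↦ ?_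
    have : u = (u.1, 0, 0) + (0, u.2.1, u.2.2) :=
      Prod.ext (add_zero _).symm (zero_add _).symm
    rw [affineWeight_apply, ← hχd u.2.1 u.2.2]
    conv_lhs => rw [this, map_add]
    rfl
  · refine UntwistedAffine.ext ?_ hc hd
    ext n
    rw [loop_tensor]
    by_cases h : r = n
    · simp [h]
    · rw [Finsupp.single_eq_of_ne' h]
      have h1 := hloop (0, 0, 1) n
      rw [hχd] at h1
      simp only [ZeroMemClass.coe_zero, zero_lie, zero_add, one_mul, mul_one] at h1
      by_contra h2
      have := smul_left_injective ℂ h2 h1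
      exact h (by exact_mod_cast this.symm)
  · refine LieModule.weightSpace_le_genWeightSpace L _ ?_
    rw [LieModule.mem_weightSpace]
    intro h
    have := hloop (h, 0, 0) r
    rwa [zero_mul, zero_smul, add_zero] at this

theorem affineWeight_ne_zero {β : Module.Dual ℂ H} (hβ : IsRoot H β) (r : ℤ) :
    affineWeight H β r ≠ 0 := fun h ↦
  hβ.1 (affineWeight_inj.1 (h.trans (affineWeight_zero H).symm)).1

theorem realRoots_subset_roots : realRoots H ⊆ roots H := by
  rintro _ ⟨β, r, h1, h2, rfl⟩
  have hβ : IsRoot H β := ⟨h1, h2⟩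
  obtain ⟨e, he, he0⟩ := hβ.exists_mem_ne_zero
  exact ⟨affineWeight_ne_zero hβ r, (Submodule.ne_bot_iff _).2
    ⟨_, tensor_mem_rootSpace r he, (tensor_eq_zero_iff r).not.2 he0⟩⟩

theorem exists_eq_tensor_of_mem {β : Module.Dual ℂ H} {r : ℤ} (h0 : affineWeight H β r ≠ 0)
    {x : UntwistedAffine L} (hx : x ∈ rootSpace H (affineWeight H β r)) :
    ∃ e ∈ LieAlgebra.rootSpace H β, x = tensor r e := by
  by_cases hx0 : x = 0
  · exact ⟨0, zero_mem _, by rw [hx0, map_zero]⟩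
  obtain ⟨γ, s, e, h1, h2, h3, -⟩ := exists_eq_tensor h0 hx hx0
  obtain ⟨rfl, rfl⟩ := affineWeight_inj.1 h1
  exact ⟨e, h3, h2⟩

theorem IsRoot.exists_isCoroot {α : Module.Dual ℂ H} (hα : IsRoot H α) (r : ℤ) :
    ∃ c, IsCoroot H (affineWeight H α r) (hα.coroot, c, 0) := by
  obtain ⟨e, f, ht, he, hf⟩ := hα.exists_sl2
  -- This is the value of the cocycle on `e ⊗ t ^ r` and `f ⊗ t ^ (-r)`.
  refine ⟨r * killingForm ℂ L e f, Submodule.subset_span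
    ⟨tensor r e, tensor_mem_rootSpace r he, tensor (-r) f, ?_, ?_⟩, ?_⟩
  · rw [affineWeight_neg]
    exact tensor_mem_rootSpace (-r) hf
  · rw [tensor_lie_tensor, ht.lie_e_f]
    refine UntwistedAffine.ext ?_ ?_ ?_ <;> simp
  · simp [affineWeight_apply, hα.apply_coroot]

theorem IsRoot.eq_of_isCoroot {α : Module.Dual ℂ H} (hα : IsRoot H α) {r : ℤ} {t : H × ℂ × ℂ}
    (ht : IsCoroot H (affineWeight H α r) t) : t.1 = hα.coroot ∧ t.2.2 = 0 := by
  obtain ⟨h1, h2⟩ := ht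
  -- The central coordinate `a` can stay undetermined, since affine weights vanish on `c`.
  have key : ∃ c a : ℂ, cartan H t = cartan H (c • hα.coroot, a, 0) := by
    generalize cartan H t = z at h1
    induction h1 using Submodule.span_induction with
    | mem z hz =>
      obtain ⟨x, hx, y, hy, rfl⟩ := hz
      obtain ⟨e, he, rfl⟩ := exists_eq_tensor_of_mem (affineWeight_ne_zero hα r) hx
      rw [affineWeight_neg] at hy
      obtain ⟨f, hf, rfl⟩ := exists_eq_tensor_of_mem (affineWeight_ne_zero hα.neg _) hy
      obtain ⟨c, hc⟩ := hα.exists_lie_eq_smul_coroot he hf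
      refine ⟨c, r * killingForm ℂ L e f, ?_⟩
      rw [tensor_lie_tensor, hc]
      refine UntwistedAffine.ext ?_ ?_ ?_ <;> simp
    | zero => exact ⟨0, 0, by rw [zero_smul]; exact (map_zero _).symm⟩
    | add x y _ _ hx hy =>
      obtain ⟨c, a, hc⟩ := hx
      obtain ⟨c', a', hc'⟩ := hy
      refine ⟨c + c', a + a', ?_⟩
      rw [hc, hc', ← map_add, Prod.mk_add_mk, Prod.mk_add_mk, ← add_smul, add_zero]
    | smul b x _ hx =>
      obtain ⟨c, a, hc⟩ := hx
      refine ⟨b * c, b * a, ?_⟩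
      rw [hc, ← map_smul, Prod.smul_mk, Prod.smul_mk, smul_smul, smul_zero, smul_eq_mul]
  obtain ⟨c, a, hc⟩ := key
  have hd : t.2.2 = 0 := congrArg dCoeff hc
  have h3 : t.1 = c • hα.coroot := Subtype.ext (Finsupp.single_injective 0 (congrArg loop hc))
  refine ⟨?_, hd⟩
  rw [affineWeight_apply, hd, h3, map_smul, hα.apply_coroot, mul_zero, add_zero, smul_eq_mul] at h2
  have : c = 1 := by linear_combination h2 / 2
  rw [h3, this, one_smul]

theorem IsClosedSystem.isSubrootSystem {Ψ : Set (CartanDual H)} (h : IsClosedSystem Ψ)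
    (hne : Ψ.Nonempty) : IsSubrootSystem H Ψ where
  nonempty := hne
  subset_roots := h.subset_realRoots.trans realRoots_subset_roots
  reflection_mem := by
    intro χ hχ _ η hη t ht
    obtain ⟨α, r, -, -, rfl⟩ := h.subset_realRoots hχ
    obtain ⟨β, s, -, -, rfl⟩ := h.subset_realRoots hη
    obtain ⟨h1, h2⟩ := (h.isRoot hχ).eq_of_isCoroot ht
    obtain ⟨p, hp⟩ := (h.isRoot hχ).exists_int_apply_coroot (h.isRoot hη)
    rw [affineWeight_apply, h2, h1, hp, mul_zero, add_zero, affineWeight_sub_zsmul]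
    exact h.reflection_mem hχ hη hp

theorem IsClosedSystem.isRealClosed {Ψ : Set (CartanDual H)} (h : IsClosedSystem Ψ) :
    IsRealClosed H Ψ :=
  ⟨h.subset_realRoots, h.add_mem⟩

theorem IsSubrootSystem.isClosedSystem {Ψ : Set (CartanDual H)} (h : IsSubrootSystem H Ψ)
    (h' : IsRealClosed H Ψ) : IsClosedSystem Ψ := by
  -- This is the reflection of `α + s δ` in `α + r δ`. Taking `s = r` gives negation, and negating
  -- the general case gives `α + (2 r - s) δ`.
  have key : ∀ (α : Module.Dual ℂ H) (r s : ℤ), affineWeight H α r ∈ Ψ → affineWeight H α s ∈ Ψ →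
      affineWeight H (-α) (s - 2 * r) ∈ Ψ := by
    intro α r s hr hs
    have hα := mem_realRoots_iff.1 (h'.subset_realRoots hr)
    obtain ⟨c, hc⟩ := hα.exists_isCoroot r
    have := h.reflection_mem _ hr (h'.subset_realRoots hr) _ hs _ hc
    rw [affineWeight_apply, hα.apply_coroot, mul_zero, add_zero,
      show (2 : ℂ) = ((2 : ℤ) : ℂ) by norm_num, affineWeight_sub_zsmul] at this
    convert! this using 2
    rw [Int.cast_ofNat, two_smul]; abel
  have hneg : ∀ χ ∈ Ψ, -χ ∈ Ψ := by
    intro χ hχ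
    obtain ⟨α, r, -, -, rfl⟩ := h'.subset_realRoots hχ
    rw [affineWeight_neg]
    have := key α r r hχ hχ
    rwa [show r - 2 * r = -r by ring] at this
  refine ⟨h'.subset_realRoots, hneg, h'.add_mem, fun α r s hr hs ↦ ?_⟩
  have := hneg _ (key α r s hr hs)
  rwa [affineWeight_neg, neg_neg, neg_sub] at this

/-! ### Regular subalgebras containing the Cartan subalgebra -/

section

variable {s s' : LieSubalgebra ℂ (UntwistedAffine L)}

theorem isRegular_of_cartan_mem (hs : ∀ t, cartan H t ∈ s) : IsRegular H s :=
  fun t _ hx ↦ s.lie_mem (hs t) hx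

theorem mem_of_sum_mem (hs : IsRegular H s) {ι : Type*} (F : Finset ι) (χ : ι → CartanDual H)
    (hχ : Set.InjOn χ F) (x : ι → UntwistedAffine L) (hx : ∀ i ∈ F, x i ∈ rootSpace H (χ i))
    (hsum : ∑ i ∈ F, x i ∈ s) : ∀ i ∈ F, x i ∈ s :=
  s.toSubmodule.mem_of_sum_mem_of_eigenvectors
    (fun t : H × ℂ × ℂ ↦ LieModule.toEnd ℂ _ (UntwistedAffine L) (cartan H t))
    (fun t x hx ↦ hs t x hx) F (fun i ↦ χ i) (DFunLike.coe_injective.comp_injOn hχ)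
    x (fun i hi t ↦ hx i hi t) hsum

theorem tensor_loop_mem (hs : ∀ t, cartan H t ∈ s) {x : UntwistedAffine L} (hx : x ∈ s) (n : ℤ) :
    tensor n (x.loop n) ∈ s := by
  have h1 : ∑ n ∈ x.loop.support, tensor n (x.loop n) ∈ s := by
    have := eq_cartan_add_sum H x
    rw [this] at hx
    exact (s.toSubmodule.add_mem_iff_right (hs _)).1 hx
  by_cases hn : n ∈ x.loop.support
  · refine s.toSubmodule.mem_of_sum_mem_of_eigenvectors
      (fun _ : Unit ↦ LieModule.toEnd ℂ _ (UntwistedAffine L) (cartan H (0, 0, 1)))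
      (fun _ x hx ↦ s.lie_mem (hs _) hx) x.loop.support (fun n _ ↦ (n : ℂ))
      (fun a _ b _ hab ↦ Int.cast_injective (congrFun hab ())) (fun n ↦ tensor n (x.loop n))
      (fun n _ _ ↦ ?_) h1 n hn
    rw [LieModule.toEnd_apply_apply, cartan_lie_tensor]
    simp
  · rw [Finsupp.notMem_support_iff.1 hn, map_zero]
    exact s.zero_mem

theorem mem_of_forall_tensor_mem (hs : ∀ t, cartan H t ∈ s) {x : UntwistedAffine L}
    (h : ∀ n, tensor n (x.loop n) ∈ s) : x ∈ s := by
  rw [eq_cartan_add_sum H x]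
  exact s.add_mem (hs _) (sum_mem fun n _ ↦ h n)

theorem exists_eq_sum_weights (e : L) : ∃ (F : Finset (Module.Dual ℂ H))
    (x : Module.Dual ℂ H → L), (∀ χ : Module.Dual ℂ H, x χ ∈ LieAlgebra.rootSpace H χ) ∧
      ∑ χ ∈ F, x χ = e := by
  have he : e ∈ ⨆ χ : Module.Dual ℂ H, (LieAlgebra.rootSpace H χ).toSubmodule := by
    have h1 : e ∈ (⊤ : LieSubmodule ℂ H L) := LieSubmodule.mem_top e
    rw [← LieModule.iSup_genWeightSpace_eq_top' ℂ H L, ← LieSubmodule.mem_toSubmodule,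
      LieSubmodule.iSup_toSubmodule] at h1
    have h2 : ⨆ χ : LieModule.Weight ℂ H L, (LieModule.genWeightSpace L χ).toSubmodule ≤
        ⨆ χ : Module.Dual ℂ H, (LieAlgebra.rootSpace H χ).toSubmodule := iSup_le fun χ ↦
      le_iSup (fun χ : Module.Dual ℂ H ↦ (LieAlgebra.rootSpace H χ).toSubmodule) χ.toLinear
    exact h2 h1
  obtain ⟨f, hf, rfl⟩ := (Submodule.mem_iSup_iff_exists_finsupp _ _).1 he
  exact ⟨f.support, f, hf, rfl⟩

theorem le_of_forall_tensor_mem (hs : ∀ t, cartan H t ∈ s) (hs' : ∀ t, cartan H t ∈ s')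
    (h : ∀ (χ : Module.Dual ℂ H) (r : ℤ), ∀ e ∈ LieAlgebra.rootSpace H χ, tensor r e ∈ s →
      tensor r e ∈ s') : s ≤ s' := by
  intro x hx
  refine mem_of_forall_tensor_mem hs' fun n ↦ ?_
  have hn := tensor_loop_mem hs hx n
  obtain ⟨F, y, hy, hsum⟩ := exists_eq_sum_weights (H := H) (x.loop n)
  rw [← hsum, map_sum] at hn ⊢
  have := mem_of_sum_mem (isRegular_of_cartan_mem hs) F (fun χ ↦ affineWeight H χ n)
    (fun a _ b _ hab ↦ (affineWeight_inj.1 hab).1) (fun χ ↦ tensor n (y χ))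
    (fun χ _ ↦ tensor_mem_rootSpace n (hy χ)) hn
  exact sum_mem fun χ hχ ↦ h χ n _ (hy χ) (this χ hχ)

theorem affineWeight_mem_rootsOf_iff {β : Module.Dual ℂ H} {r : ℤ} :
    affineWeight H β r ∈ rootsOf H s ↔ affineWeight H β r ≠ 0 ∧
      ∃ e ∈ LieAlgebra.rootSpace H β, e ≠ 0 ∧ tensor r e ∈ s := by
  constructor
  · rintro ⟨⟨h0, -⟩, h2⟩
    obtain ⟨x, ⟨hx, hxs⟩, hx0⟩ := (Submodule.ne_bot_iff _).1 h2
    obtain ⟨e, he, rfl⟩ := exists_eq_tensor_of_mem h0 hx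
    exact ⟨h0, e, he, (tensor_eq_zero_iff r).not.1 hx0, hxs⟩
  · rintro ⟨h0, e, he, he0, hes⟩
    have h1 := tensor_mem_rootSpace r he
    have h2 := (tensor_eq_zero_iff r).not.2 he0
    exact ⟨⟨h0, (Submodule.ne_bot_iff _).2 ⟨_, h1, h2⟩⟩,
      (Submodule.ne_bot_iff _).2 ⟨_, ⟨h1, hes⟩, h2⟩⟩

theorem exists_eq_affineWeight {χ : CartanDual H} (h : χ ∈ roots H) :
    ∃ β r, χ = affineWeight H β r := by
  obtain ⟨x, hx, hx0⟩ := (Submodule.ne_bot_iff _).1 h.2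
  obtain ⟨β, r, -, h1, -⟩ := exists_eq_tensor h.1 hx hx0
  exact ⟨β, r, h1⟩

theorem tensor_mem_of_mem_realRootsOf {β : Module.Dual ℂ H} {r : ℤ}
    (h : affineWeight H β r ∈ realRootsOf H s) {e : L} (he : e ∈ LieAlgebra.rootSpace H β) :
    tensor r e ∈ s := by
  obtain ⟨-, f, hf, hf0, hfs⟩ := affineWeight_mem_rootsOf_iff.1 h.2
  obtain ⟨c, rfl⟩ := (mem_realRoots_iff.1 h.1).exists_smul_eq hf hf0 he
  rw [map_smul]
  exact s.smul_mem c hfs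

theorem mem_realRootsOf {β : Module.Dual ℂ H} (hβ : IsRoot H β) {r : ℤ} {e : L}
    (he : e ∈ LieAlgebra.rootSpace H β) (he0 : e ≠ 0) (hes : tensor r e ∈ s) :
    affineWeight H β r ∈ realRootsOf H s :=
  ⟨mem_realRoots_iff.2 hβ, affineWeight_mem_rootsOf_iff.2
    ⟨affineWeight_ne_zero hβ r, e, he, he0, hes⟩⟩

theorem mk_zero_zero_mem (hs : ∀ t, cartan H t ∈ s) (a : ℂ) : mk 0 a 0 ∈ s := by
  have : cartan H (0, a, 0) = mk 0 a 0 := UntwistedAffine.ext (by simp) (by simp) (by simp)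
  exact this ▸ hs _

theorem tensor_lie_mem (hs : ∀ t, cartan H t ∈ s) {r r' : ℤ} {x y : L} (hx : tensor r x ∈ s)
    (hy : tensor r' y ∈ s) : tensor (r + r') ⁅x, y⁆ ∈ s := by
  have := s.lie_mem hx hy
  rw [tensor_lie_tensor] at this
  exact (s.toSubmodule.add_mem_iff_left (mk_zero_zero_mem hs _)).1 this

theorem add_mem_realRootsOf (hs : ∀ t, cartan H t ∈ s) {h : H} {r t : ℤ} {β : Module.Dual ℂ H}
    (hh : tensor r (h : L) ∈ s) (hβ : affineWeight H β t ∈ realRootsOf H s) (h0 : β h ≠ 0) :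
    affineWeight H β (t + r) ∈ realRootsOf H s := by
  have hβ' := mem_realRoots_iff.1 hβ.1
  obtain ⟨e, he, he0⟩ := hβ'.exists_mem_ne_zero
  have h1 := tensor_lie_mem hs hh (tensor_mem_of_mem_realRootsOf hβ he)
  rw [IsRoot.lie_eq β he h, add_comm] at h1
  exact mem_realRootsOf hβ' ((LieAlgebra.rootSpace H β).smul_mem _ he) (smul_ne_zero h0 he0) h1

theorem isClosedSystem_realRootsOf (hs : ∀ t, cartan H t ∈ s) (hsymm : IsSymmetric H s) :
    IsClosedSystem (realRootsOf H s) := by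
  have hneg : ∀ χ ∈ realRootsOf H s, -χ ∈ realRootsOf H s := by
    rintro χ ⟨⟨β, r, h1, h2, rfl⟩, h3⟩
    refine ⟨?_, (hsymm _).1 h3⟩
    rw [affineWeight_neg]
    exact mem_realRoots_iff.2 (IsRoot.neg ⟨h1, h2⟩)
  refine ⟨Set.inter_subset_left, hneg, ?_, ?_⟩
  · intro χ hχ η hη h
    obtain ⟨α, r, h1, h2, rfl⟩ := hχ.1
    obtain ⟨β, t, h3, h4, rfl⟩ := hη.1
    rw [affineWeight_add] at h ⊢
    have hα : IsRoot H α := ⟨h1, h2⟩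
    have hβ : IsRoot H β := ⟨h3, h4⟩
    have hαβ := mem_realRoots_iff.1 h
    obtain ⟨e, he, he0⟩ := hα.exists_mem_ne_zero
    obtain ⟨f, hf, hf0⟩ := hβ.exists_mem_ne_zero
    exact mem_realRootsOf hαβ (IsRoot.lie_mem he hf) (hα.lie_ne_zero hβ hαβ he hf he0 hf0)
      (tensor_lie_mem hs (tensor_mem_of_mem_realRootsOf hχ he)
        (tensor_mem_of_mem_realRootsOf hη hf))
  · intro α r t hr ht
    have hα := mem_realRoots_iff.1 hr.1
    obtain ⟨e, f, hsl, he, hf⟩ := hα.exists_sl2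
    have h1 := hneg _ ht
    rw [affineWeight_neg] at h1
    -- The bracket puts the coroot of `α` in degree `r - t` into `s`, and acting with it shifts `α +
    -- r δ` to `α + (2 r - t) δ`.
    have h2 := tensor_lie_mem hs (tensor_mem_of_mem_realRootsOf hr he)
      (tensor_mem_of_mem_realRootsOf h1 hf)
    rw [hsl.lie_e_f] at h2
    have h3 := add_mem_realRootsOf hs h2 hr (by rw [hα.apply_coroot]; exact two_ne_zero)
    rwa [show r + (r + -t) = 2 * r - t by ring] at h3

theorem eq_top_of_realRoots_subset (hs : ∀ t, cartan H t ∈ s) (h : realRoots H ⊆ realRootsOf H s) :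
    s = ⊤ := by
  have hroot {β : Module.Dual ℂ H} (hβ : IsRoot H β) (r : ℤ) {e : L}
      (he : e ∈ LieAlgebra.rootSpace H β) : tensor r e ∈ s :=
    tensor_mem_of_mem_realRootsOf (h (mem_realRoots_iff.2 hβ)) he
  have hzero (e : L) : tensor 0 e ∈ s := by
    obtain ⟨F, x, hx, rfl⟩ := exists_eq_sum_weights (H := H) e
    rw [map_sum]
    refine sum_mem fun χ _ ↦ ?_
    by_cases hχ : χ = 0
    · have := hx χ
      rw [hχ, mem_rootSpace_zero_iff] at this
      exact hχ ▸ hs (⟨x 0, this⟩, 0, 0)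
    · by_cases hx0 : x χ = 0
      · rw [hx0, map_zero]; exact s.zero_mem
      · exact hroot ⟨hχ, fun hb ↦ hx0 (by simpa [hb] using hx χ)⟩ 0 (hx χ)
  obtain ⟨β, hβ⟩ := IsRoot.exists_isRoot H
  obtain ⟨e, he, he0⟩ := hβ.exists_mem_ne_zero
  refine eq_top_iff.2 fun x _ ↦ mem_of_forall_tensor_mem hs fun r ↦ ?_
  -- As `s` contains `L ⊗ 1`, its degree `r` part is an ideal of the simple algebra `L`. It contains
  -- a root vector, so it is everything.
  let I : LieIdeal ℂ L :=
    { s.toSubmodule.comap (tensor r) with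
      lie_mem := fun {x y} hy ↦ by
        have := s.lie_mem (hzero x) hy
        rwa [tensor_zero_lie_tensor] at this }
  have hI : I = ⊤ := (LieAlgebra.IsSimple.eq_bot_or_eq_top I).resolve_left fun hb ↦
    he0 ((LieSubmodule.mem_bot e).1 (hb ▸ (show e ∈ I from hroot hβ r he)))
  exact (hI ▸ LieSubmodule.mem_top (x.loop r) : x.loop r ∈ I)

/-! ### Adjoining the Cartan subalgebra, and the derived algebra -/

/-- The sum of a regular subalgebra and the Cartan subalgebra. -/
def supCartan (hs : IsRegular H s) : LieSubalgebra ℂ (UntwistedAffine L) :=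
  { s.toSubmodule ⊔ LinearMap.range (cartan H) with
    lie_mem' := by
      intro x y hx hy
      obtain ⟨a, ha, _, ⟨t, rfl⟩, rfl⟩ := Submodule.mem_sup.1 hx
      obtain ⟨b, hb, _, ⟨u, rfl⟩, rfl⟩ := Submodule.mem_sup.1 hy
      refine Submodule.mem_sup_left ?_
      rw [add_lie, lie_add, lie_add, cartan_lie_cartan, add_zero, ← lie_skew a (cartan H u)]
      exact s.add_mem (s.add_mem (s.lie_mem ha hb) (s.neg_mem (hs u a ha))) (hs t b hb) }

theorem mem_supCartan (hs : IsRegular H s) {x : UntwistedAffine L} :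
    x ∈ supCartan hs ↔ ∃ y ∈ s, ∃ t, y + cartan H t = x := by
  change x ∈ s.toSubmodule ⊔ LinearMap.range (cartan H) ↔ _
  rw [Submodule.mem_sup]
  simp

theorem le_supCartan (hs : IsRegular H s) : s ≤ supCartan hs := fun x hx ↦
  (mem_supCartan hs).2 ⟨x, hx, 0, by rw [map_zero, add_zero]⟩

theorem cartan_mem_supCartan (hs : IsRegular H s) (t : H × ℂ × ℂ) : cartan H t ∈ supCartan hs :=
  (mem_supCartan hs).2 ⟨0, s.zero_mem, t, zero_add _⟩

theorem mem_of_mem_supCartan (hs : IsRegular H s) {χ : CartanDual H} (hχ : χ ≠ 0)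
    {x : UntwistedAffine L} (hx : x ∈ rootSpace H χ) (h : x ∈ supCartan hs) : x ∈ s := by
  obtain ⟨y, hy, t, rfl⟩ := (mem_supCartan hs).1 h
  -- The element `y` of `s` is the sum of `y + cartan H t`, of weight `χ`, and `-cartan H t`, of
  -- weight `0`. As `χ ≠ 0`, each summand lies in `s`.
  have h1 := mem_of_sum_mem hs Finset.univ (fun b : Bool ↦ if b then χ else 0)
    (fun a _ b _ hab ↦ by cases a <;> cases b <;> simp_all [eq_comm])
    (fun b ↦ if b then y + cartan H t else -cartan H t)
    (fun b _ ↦ by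
      cases b
      · simp only [Bool.false_eq_true, if_false]
        refine (rootSpace H 0).neg_mem fun u ↦ ?_
        rw [cartan_lie_cartan, LinearMap.zero_apply, zero_smul]
      · simpa using hx)
    (by simpa using hy) true (Finset.mem_univ _)
  simpa using h1

theorem rootsOf_supCartan (hs : IsRegular H s) : rootsOf H (supCartan hs) = rootsOf H s := by
  ext χ
  refine and_congr_right fun hχ ↦ ?_
  have : rootSpace H χ ⊓ (supCartan hs).toSubmodule = rootSpace H χ ⊓ s.toSubmodule :=
    le_antisymm (fun x hx ↦ ⟨hx.1, mem_of_mem_supCartan hs hχ.1 hx.1 hx.2⟩)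
      (inf_le_inf_left _ (le_supCartan hs))
  rw [this]

theorem dCoeff_eq_zero_of_mem_derivedAlgebra {x : UntwistedAffine L}
    (hx : x ∈ derivedAlgebra L) : x.dCoeff = 0 := by
  have hx' : x ∈ (⁅(⊤ : LieIdeal ℂ (UntwistedAffine L)), (⊤ : LieIdeal ℂ (UntwistedAffine L))⁆ :
    LieIdeal ℂ (UntwistedAffine L)) := hx
  clear hx
  rw [← LieSubmodule.mem_toSubmodule, LieSubmodule.lieIdeal_oper_eq_linear_span'] at hx'
  induction hx' using Submodule.span_induction with
  | mem z hz => obtain ⟨x, -, y, -, rfl⟩ := hz; rfl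
  | zero => rfl
  | add x y _ _ hx hy => rw [dCoeff_add, hx, hy, add_zero]
  | smul a x _ hx => rw [dCoeff_smul, hx, mul_zero]

theorem lie_mem_derivedAlgebra (x y : UntwistedAffine L) : ⁅x, y⁆ ∈ derivedAlgebra L :=
  LieSubmodule.lie_mem_lie (LieSubmodule.mem_top x) (LieSubmodule.mem_top y)

theorem derivedAlgebra_le {s : LieSubalgebra ℂ (UntwistedAffine L)}
    (h : ∀ x y : UntwistedAffine L, ⁅x, y⁆ ∈ s) :
    derivedAlgebra L ≤ s := by
  intro x hx
  have hx' : x ∈ (⁅(⊤ : LieIdeal ℂ (UntwistedAffine L)), (⊤ : LieIdeal ℂ (UntwistedAffine L))⁆ :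
    LieIdeal ℂ (UntwistedAffine L)) := hx
  rw [← LieSubmodule.mem_toSubmodule, LieSubmodule.lieIdeal_oper_eq_linear_span'] at hx'
  refine (Submodule.span_le (p := s.toSubmodule)).2 ?_ hx'
  rintro _ ⟨x, -, y, -, rfl⟩
  exact h x y

theorem mem_derivedAlgebra_of_dCoeff_eq_zero (H : LieSubalgebra ℂ L) [H.IsCartanSubalgebra]
    {x : UntwistedAffine L} (hx : x.dCoeff = 0) :
    x ∈ derivedAlgebra L := by
  have hperf (r : ℤ) (e : L) : tensor r e ∈ derivedAlgebra L := by
    let I : LieIdeal ℂ L :=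
      { (derivedAlgebra L).toSubmodule.comap (tensor r) with
        lie_mem := fun {x y} _ ↦ by
          have := lie_mem_derivedAlgebra (tensor 0 x) (tensor r y)
          rwa [tensor_zero_lie_tensor] at this }
    have hI : I = ⊤ := by
      refine (LieAlgebra.IsSimple.eq_bot_or_eq_top I).resolve_left fun hb ↦
        LieAlgebra.IsSimple.non_abelian (R := ℂ) (L := L) ⟨fun x y ↦ ?_⟩
      have h1 : ⁅x, y⁆ ∈ I := by
        have := lie_mem_derivedAlgebra (tensor 0 x) (tensor r y)
        rwa [tensor_zero_lie_tensor] at this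
      rwa [hb, LieSubmodule.mem_bot] at h1
    exact (hI ▸ LieSubmodule.mem_top e : e ∈ I)
  have hc (a : ℂ) : mk 0 a 0 ∈ derivedAlgebra L := by
    obtain ⟨x, y, h⟩ : ∃ x y : L, killingForm ℂ L x y ≠ 0 := by
      by_contra! h
      obtain ⟨β, hβ⟩ := IsRoot.exists_isRoot H
      obtain ⟨e, -, he0⟩ := hβ.exists_mem_ne_zero
      exact he0 ((LieAlgebra.IsKilling.killingForm_nondegenerate ℂ L).1 e (h e))
    -- The loop part of this bracket is already in the derived algebra, so what remains is a nonzero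
    -- multiple of `c`.
    have h1 := lie_mem_derivedAlgebra (tensor 1 x) (tensor (-1) y)
    rw [tensor_lie_tensor] at h1
    have h2 := ((derivedAlgebra L).toSubmodule.add_mem_iff_right (hperf _ _)).1 h1
    have h3 := (derivedAlgebra L).smul_mem (a / killingForm ℂ L x y) h2
    convert! h3 using 1
    refine UntwistedAffine.ext ?_ ?_ ?_
    · simp
    · simp [h]
    · simp
  rw [eq_cartan_add_sum H x, hx]
  refine add_mem ?_ (sum_mem fun n _ ↦ hperf n _)
  convert! hc x.cCoeff
  exact UntwistedAffine.ext (by simp) (by simp) (by simp)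

end

/-! ### The largest subalgebra with given real roots -/

/-- The set of those `h ∈ H` for which `h ⊗ t ^ r` normalizes the span of the root spaces of the
elements of `Ψ`. -/
def periodSpace (Ψ : Set (CartanDual H)) (r : ℤ) : Submodule ℂ H where
  carrier := {h | ∀ β : Module.Dual ℂ H, IsRoot H β → ¬ IsPeriod Ψ β r → β h = 0}
  add_mem' ha hb β h1 h2 := by rw [map_add, ha β h1 h2, hb β h1 h2, add_zero]
  zero_mem' β _ _ := map_zero β
  smul_mem' c _ ha β h1 h2 := by rw [map_smul, ha β h1 h2, smul_zero]

theorem mem_periodSpace_of_forall {Ψ : Set (CartanDual H)} {r : ℤ}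
    (h : ∀ β, IsRoot H β → IsPeriod Ψ β r) (x : H) : x ∈ periodSpace Ψ r :=
  fun β hβ hn ↦ absurd (h β hβ) hn

theorem periodSpace_zero (Ψ : Set (CartanDual H)) (x : H) : x ∈ periodSpace Ψ 0 :=
  mem_periodSpace_of_forall (fun _ _ s hs ↦ by rwa [add_zero]) x

open Classical in
/-- The part of weight `χ` of the degree `r` part of the largest subalgebra with real roots `Ψ`. -/
def weightPiece (Ψ : Set (CartanDual H)) (r : ℤ) (χ : Module.Dual ℂ H) : Submodule ℂ L :=
  if χ = 0 then (periodSpace Ψ r).map H.toSubmodule.subtype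
  else if affineWeight H χ r ∈ Ψ then (LieAlgebra.rootSpace H χ).toSubmodule else ⊥

/-- The degree `r` part of the largest subalgebra with real roots `Ψ`. -/
def gradedPiece (Ψ : Set (CartanDual H)) (r : ℤ) : Submodule ℂ L := ⨆ χ, weightPiece Ψ r χ

section

variable {Ψ : Set (CartanDual H)} {r s : ℤ} {χ η : Module.Dual ℂ H}

theorem mem_weightPiece_zero {e : L} :
    e ∈ weightPiece Ψ r (0 : Module.Dual ℂ H) ↔ ∃ h ∈ periodSpace Ψ r, (h : L) = e := by
  rw [weightPiece, if_pos rfl]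
  rfl

theorem mem_weightPiece (hχ : χ ≠ 0) {e : L} : e ∈ weightPiece Ψ r χ ↔
    e ∈ LieAlgebra.rootSpace H χ ∧ (affineWeight H χ r ∈ Ψ ∨ e = 0) := by
  rw [weightPiece, if_neg hχ]
  split_ifs with h
  · simp [h]
  · simp only [Submodule.mem_bot, h, false_or]
    exact ⟨fun h ↦ ⟨h ▸ zero_mem _, h⟩, fun h ↦ h.2⟩

theorem weightPiece_le (Ψ : Set (CartanDual H)) (r : ℤ) (χ : Module.Dual ℂ H) :
    weightPiece Ψ r χ ≤ (LieAlgebra.rootSpace H χ).toSubmodule := by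
  intro e he
  by_cases hχ : χ = 0
  · subst hχ
    obtain ⟨h, -, rfl⟩ := mem_weightPiece_zero.1 he
    exact mem_rootSpace_zero_iff.2 h.2
  · exact ((mem_weightPiece hχ).1 he).1

/-- The weight pieces sit inside the independent weight spaces of `L`, so a weight vector in their
sum comes from its own piece. -/
theorem mem_gradedPiece {e : L} (he : e ∈ LieAlgebra.rootSpace H χ) :
    e ∈ gradedPiece Ψ r ↔ e ∈ weightPiece Ψ r χ := by
  refine ⟨fun h ↦ ?_, fun h ↦ Submodule.mem_iSup_of_mem χ h⟩
  have hind : iSupIndep fun χ : Module.Dual ℂ H ↦ (LieAlgebra.rootSpace H χ).toSubmodule :=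
    (LieSubmodule.iSupIndep_toSubmodule.2 (LieModule.iSupIndep_genWeightSpace ℂ H L)).comp
      DFunLike.coe_injective
  have h1 : gradedPiece Ψ r ≤ weightPiece Ψ r χ ⊔
      ⨆ (η) (_ : η ≠ χ), (LieAlgebra.rootSpace H η).toSubmodule := by
    refine iSup_le fun η ↦ ?_
    by_cases hη : η = χ
    · rw [hη]; exact le_sup_left
    · exact le_sup_of_le_right (le_iSup₂_of_le η hη (weightPiece_le Ψ r η))
  obtain ⟨a, ha, b, hb, rfl⟩ := Submodule.mem_sup.1 (h1 h)
  have hb' : b ∈ LieAlgebra.rootSpace H χ :=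
    ((LieAlgebra.rootSpace H χ).toSubmodule.add_mem_iff_right (weightPiece_le Ψ r χ ha)).1 he
  have : b = 0 := Submodule.disjoint_def.1 (hind χ) b hb' hb
  rwa [this, add_zero]

theorem IsClosedSystem.lie_mem_weightPiece (h : IsClosedSystem Ψ) {e f : L}
    (he : e ∈ weightPiece Ψ r χ) (hf : f ∈ weightPiece Ψ s η) :
    ⁅e, f⁆ ∈ weightPiece Ψ (r + s) (χ + η) := by
  have key : ∀ {r s : ℤ} {η : Module.Dual ℂ H} {x : H} {f : L}, η ≠ 0 → x ∈ periodSpace Ψ r →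
      f ∈ weightPiece Ψ s η → ⁅(x : L), f⁆ ∈ weightPiece Ψ (s + r) η := by
    intro r s η x f hη hx hf
    obtain ⟨hf1, hf2⟩ := (mem_weightPiece hη).1 hf
    rw [IsRoot.lie_eq η hf1]
    rcases hf2 with hf2 | rfl
    · by_cases h0 : IsPeriod Ψ η r
      · exact (mem_weightPiece hη).2 ⟨(LieAlgebra.rootSpace H η).smul_mem _ hf1, .inl (h0 _ hf2)⟩
      · rw [hx η (h.isRoot hf2) h0, zero_smul]
        exact zero_mem _
    · rw [smul_zero]
      exact zero_mem _
  by_cases hχ : χ = 0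
  · subst hχ
    obtain ⟨x, hx, rfl⟩ := mem_weightPiece_zero.1 he
    by_cases hη : η = 0
    · subst hη
      obtain ⟨y, hy, rfl⟩ := mem_weightPiece_zero.1 hf
      have : ⁅(x : L), (y : L)⁆ = 0 := by
        rw [← LieSubalgebra.coe_bracket, trivial_lie_zero, ZeroMemClass.coe_zero]
      rw [this]
      exact zero_mem _
    · rw [zero_add, add_comm r]
      exact key hη hx hf
  · by_cases hη : η = 0
    · subst hη
      obtain ⟨y, hy, rfl⟩ := mem_weightPiece_zero.1 hf
      rw [add_zero, ← lie_skew]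
      exact Submodule.neg_mem _ (key hχ hy he)
    obtain ⟨he1, he2⟩ := (mem_weightPiece hχ).1 he
    obtain ⟨hf1, hf2⟩ := (mem_weightPiece hη).1 hf
    rcases he2 with he2 | rfl
    swap
    · rw [zero_lie]; exact zero_mem _
    rcases hf2 with hf2 | rfl
    swap
    · rw [lie_zero]; exact zero_mem _
    by_cases h0 : χ + η = 0
    · obtain rfl : η = -χ := (neg_eq_of_add_eq_zero_right h0).symm
      obtain ⟨c, hc⟩ := (h.isRoot he2).exists_lie_eq_smul_coroot he1 hf1
      rw [hc, h0]
      -- A root that does not vanish on the coroot has `r + s` as a period, by `isPeriod_add`.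
      refine mem_weightPiece_zero.2 ⟨_, (periodSpace Ψ _).smul_mem c fun β hβ hn ↦ ?_, rfl⟩
      by_contra h1
      exact hn (h.isPeriod_add he2 hf2 hβ h1)
    · have h1 := IsRoot.lie_mem he1 hf1
      refine (mem_weightPiece h0).2 ⟨h1, ?_⟩
      by_cases h2 : ⁅e, f⁆ = 0
      · exact .inr h2
      · exact .inl (h.affineWeight_add_mem he2 hf2
          ⟨h0, fun hb ↦ h2 (by simpa [hb] using h1)⟩)

theorem IsClosedSystem.lie_mem_gradedPiece (h : IsClosedSystem Ψ) {e f : L}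
    (he : e ∈ gradedPiece Ψ r) (hf : f ∈ gradedPiece Ψ s) : ⁅e, f⁆ ∈ gradedPiece Ψ (r + s) := by
  induction he using Submodule.iSup_induction' with
  | zero => rw [zero_lie]; exact zero_mem _
  | add x y _ _ hx hy => rw [add_lie]; exact Submodule.add_mem _ hx hy
  | mem χ x hx =>
    induction hf using Submodule.iSup_induction' with
    | zero => rw [lie_zero]; exact zero_mem _
    | add y z _ _ hy hz => rw [lie_add]; exact Submodule.add_mem _ hy hz
    | mem η y hy => exact Submodule.mem_iSup_of_mem _ (h.lie_mem_weightPiece hx hy)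

theorem coe_mem_gradedPiece_zero (Ψ : Set (CartanDual H)) (x : H) : (x : L) ∈ gradedPiece Ψ 0 :=
  Submodule.mem_iSup_of_mem 0 (mem_weightPiece_zero.2 ⟨x, periodSpace_zero Ψ x, rfl⟩)

theorem loopLie_apply_mem (P : ℤ → Submodule ℂ L)
    (hP : ∀ r s, ∀ x ∈ P r, ∀ y ∈ P s, ⁅x, y⁆ ∈ P (r + s)) {f g : ℤ →₀ L}
    (hf : ∀ n, f n ∈ P n) (hg : ∀ n, g n ∈ P n) (n : ℤ) : loopLie L f g n ∈ P n := by
  change (f.sum fun m x ↦ g.sum fun n y ↦ Finsupp.single (m + n) ⁅x, y⁆) n ∈ P n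
  rw [Finsupp.sum_apply]
  refine sum_mem fun a _ ↦ ?_
  change (g.sum fun n y ↦ Finsupp.single (a + n) ⁅f a, y⁆) n ∈ P n
  rw [Finsupp.sum_apply]
  refine sum_mem fun b _ ↦ ?_
  change Finsupp.single (a + b) ⁅f a, g b⁆ n ∈ P n
  by_cases h : a + b = n
  · subst h
    rw [Finsupp.single_eq_same]
    exact hP a b _ (hf a) _ (hg b)
  · rw [Finsupp.single_eq_of_ne' h]
    exact zero_mem _

/-- The largest regular subalgebra containing the Cartan subalgebra whose real roots are the
elements of `Ψ`. -/
def IsClosedSystem.subalgebra (h : IsClosedSystem Ψ) :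
    LieSubalgebra ℂ (UntwistedAffine L) where
  carrier := {x | ∀ n, x.loop n ∈ gradedPiece Ψ n}
  add_mem' hx hy n := Submodule.add_mem _ (hx n) (hy n)
  zero_mem' n := zero_mem _
  smul_mem' c _ hx n := Submodule.smul_mem _ c (hx n)
  lie_mem' {x y} hx hy n := by
    rw [loop_lie, Finsupp.sub_apply, Finsupp.add_apply, Finsupp.smul_apply, Finsupp.smul_apply,
      degreeOp_apply, degreeOp_apply]
    refine Submodule.sub_mem _ (Submodule.add_mem _ ?_ ?_) ?_
    · exact loopLie_apply_mem _ (fun _ _ _ hx _ hy ↦ h.lie_mem_gradedPiece hx hy) hx hy n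
    · exact Submodule.smul_mem _ _ (Submodule.smul_mem _ _ (hy n))
    · exact Submodule.smul_mem _ _ (Submodule.smul_mem _ _ (hx n))

end

namespace IsClosedSystem

variable {Ψ : Set (CartanDual H)} (h : IsClosedSystem Ψ) {r : ℤ} {β : Module.Dual ℂ H}

theorem mem_subalgebra {x : UntwistedAffine L} :
    x ∈ h.subalgebra ↔ ∀ n, x.loop n ∈ gradedPiece Ψ n := Iff.rfl

theorem tensor_mem_subalgebra {e : L} : tensor r e ∈ h.subalgebra ↔ e ∈ gradedPiece Ψ r := by
  rw [mem_subalgebra, loop_tensor]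
  refine ⟨fun h ↦ by simpa using h r, fun h n ↦ ?_⟩
  by_cases hn : r = n
  · subst hn; simpa using h
  · rw [Finsupp.single_eq_of_ne' hn]; exact zero_mem _

theorem cartan_mem_subalgebra (t : H × ℂ × ℂ) : cartan H t ∈ h.subalgebra := by
  rw [mem_subalgebra]
  intro n
  rw [loop_cartan]
  by_cases hn : 0 = n
  · subst hn; simpa using coe_mem_gradedPiece_zero Ψ t.1
  · rw [Finsupp.single_eq_of_ne' hn]; exact zero_mem _

theorem tensor_coe_mem_subalgebra {x : H} :
    tensor r (x : L) ∈ h.subalgebra ↔ x ∈ periodSpace Ψ r := by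
  rw [tensor_mem_subalgebra, mem_gradedPiece (mem_rootSpace_zero_iff.2 x.2), mem_weightPiece_zero]
  exact ⟨fun ⟨y, hy, hxy⟩ ↦ Subtype.ext hxy ▸ hy, fun hx ↦ ⟨x, hx, rfl⟩⟩

theorem tensor_mem_subalgebra_of_ne_zero (hβ : β ≠ 0) {e : L}
    (he : e ∈ LieAlgebra.rootSpace H β) :
    tensor r e ∈ h.subalgebra ↔ affineWeight H β r ∈ Ψ ∨ e = 0 := by
  rw [tensor_mem_subalgebra, mem_gradedPiece he, mem_weightPiece hβ, and_iff_right]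
  exact he

theorem realRootsOf_subalgebra : realRootsOf H h.subalgebra = Ψ := by
  ext χ
  constructor
  · rintro ⟨⟨β, r, h1, h2, rfl⟩, h3⟩
    obtain ⟨-, e, he, he0, hes⟩ := affineWeight_mem_rootsOf_iff.1 h3
    exact ((h.tensor_mem_subalgebra_of_ne_zero h1 he).1 hes).resolve_right he0
  · intro hχ
    obtain ⟨β, r, h1, h2, rfl⟩ := h.subset_realRoots hχ
    obtain ⟨e, he, he0⟩ := IsRoot.exists_mem_ne_zero (H := H) ⟨h1, h2⟩
    exact mem_realRootsOf ⟨h1, h2⟩ he he0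
      ((h.tensor_mem_subalgebra_of_ne_zero h1 he).2 (.inl hχ))

theorem isSymmetric_subalgebra : IsSymmetric H h.subalgebra := by
  have key : ∀ χ ∈ rootsOf H h.subalgebra, -χ ∈ rootsOf H h.subalgebra := by
    intro χ hχ
    obtain ⟨β, r, rfl⟩ := exists_eq_affineWeight hχ.1
    obtain ⟨h0, e, he, he0, hes⟩ := affineWeight_mem_rootsOf_iff.1 hχ
    -- Symmetry also concerns the imaginary roots `r δ`. There it holds because `r` and `-r` are
    -- periods simultaneously.
    by_cases hβ : β = 0
    · subst hβ
      have heH := mem_rootSpace_zero_iff.1 he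
      have h1 : (⟨e, heH⟩ : H) ∈ periodSpace Ψ (-r) := fun γ hγ hn ↦
        (h.tensor_coe_mem_subalgebra (x := ⟨e, heH⟩)).1 hes γ hγ
          fun hp ↦ hn (h.isPeriod_neg_right hp)
      rw [affineWeight_neg, neg_zero]
      refine affineWeight_mem_rootsOf_iff.2 ⟨fun h2 ↦ h0 ?_, e, he, he0,
        (h.tensor_coe_mem_subalgebra (x := ⟨e, heH⟩)).2 h1⟩
      rw [← neg_eq_zero, affineWeight_neg, neg_zero, h2]
    · have hΨ := ((h.tensor_mem_subalgebra_of_ne_zero hβ he).1 hes).resolve_right he0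
      rw [← h.realRootsOf_subalgebra] at hΨ
      have := h.neg_mem _ (h.realRootsOf_subalgebra ▸ hΨ)
      rw [← h.realRootsOf_subalgebra] at this
      exact this.2
  exact fun χ ↦ ⟨key χ, fun hχ ↦ neg_neg χ ▸ key _ hχ⟩

theorem subalgebra_ne_top (hne : Ψ ≠ realRoots H) : h.subalgebra ≠ ⊤ := fun htop ↦ by
  refine hne (h.subset_realRoots.antisymm fun χ hχ ↦ ?_)
  obtain ⟨β, r, h1, h2, rfl⟩ := hχ
  obtain ⟨e, he, he0⟩ := IsRoot.exists_mem_ne_zero (H := H) ⟨h1, h2⟩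
  exact ((h.tensor_mem_subalgebra_of_ne_zero h1 he).1
    (htop ▸ LieSubalgebra.mem_top _)).resolve_right he0

theorem subalgebra_ne_derivedAlgebra : h.subalgebra ≠ derivedAlgebra L := fun he ↦ by
  have := dCoeff_eq_zero_of_mem_derivedAlgebra (he ▸ h.cartan_mem_subalgebra (0, 0, 1))
  exact one_ne_zero this

/-- The separate condition on the vectors `x ⊗ t ^ r` with `x` in `H` is needed when `Ψ` is larger
than the real roots of `s`: a bigger system may have fewer periods. -/
theorem le_subalgebra {s : LieSubalgebra ℂ (UntwistedAffine L)} (hs : ∀ t, cartan H t ∈ s)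
    (h1 : realRootsOf H s ⊆ Ψ) (h2 : ∀ (r : ℤ) (x : H), tensor r (x : L) ∈ s →
      x ∈ periodSpace Ψ r) : s ≤ h.subalgebra := by
  refine le_of_forall_tensor_mem hs h.cartan_mem_subalgebra fun χ r e he hes ↦ ?_
  by_cases hχ : χ = 0
  · subst hχ
    have heH := mem_rootSpace_zero_iff.1 he
    exact (h.tensor_coe_mem_subalgebra (x := ⟨e, heH⟩)).2 (h2 r ⟨e, heH⟩ hes)
  · rw [h.tensor_mem_subalgebra_of_ne_zero hχ he, or_iff_not_imp_right]
    intro he0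
    exact h1 (mem_realRootsOf ⟨hχ, fun hb ↦ he0 (by simpa [hb] using he)⟩ he he0 hes)

end IsClosedSystem

/-! ### Maximal subalgebras and maximal closed systems -/

theorem mem_periodSpace_realRootsOf {s : LieSubalgebra ℂ (UntwistedAffine L)}
    (hs : ∀ t, cartan H t ∈ s) {r : ℤ} {x : H} (hx : tensor r (x : L) ∈ s) :
    x ∈ periodSpace (realRootsOf H s) r := fun β _ hn ↦ by
  by_contra h0
  exact hn fun t ht ↦ add_mem_realRootsOf hs hx ht h0

section

variable {s : LieSubalgebra ℂ (UntwistedAffine L)} {Ψ : Set (CartanDual H)}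

theorem derivedAlgebra_le_of_supCartan_eq_top (hs : IsRegular H s) (h : supCartan hs = ⊤) :
    derivedAlgebra L ≤ s := by
  refine derivedAlgebra_le fun x y ↦ ?_
  obtain ⟨a, ha, t, rfl⟩ := (mem_supCartan hs).1 (h ▸ LieSubalgebra.mem_top x)
  obtain ⟨b, hb, u, rfl⟩ := (mem_supCartan hs).1 (h ▸ LieSubalgebra.mem_top y)
  rw [add_lie, lie_add, lie_add, cartan_lie_cartan, add_zero, ← lie_skew a (cartan H u)]
  exact s.add_mem (s.add_mem (s.lie_mem ha hb) (s.neg_mem (hs u a ha))) (hs t b hb)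

theorem eq_derivedAlgebra_of_le (H : LieSubalgebra ℂ L) [H.IsCartanSubalgebra]
    (h : derivedAlgebra L ≤ s) (hne : s ≠ ⊤) : s = derivedAlgebra L := by
  refine le_antisymm (fun x hx ↦ mem_derivedAlgebra_of_dCoeff_eq_zero H ?_) h
  by_contra h0
  refine hne (eq_top_iff.2 fun y _ ↦ ?_)
  have h1 : y - (y.dCoeff / x.dCoeff) • x ∈ s := by
    refine h (mem_derivedAlgebra_of_dCoeff_eq_zero H ?_)
    rw [sub_eq_add_neg, ← neg_smul, dCoeff_add, dCoeff_smul]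
    field_simp
    ring
  have := s.add_mem h1 (s.smul_mem (y.dCoeff / x.dCoeff) hx)
  rwa [sub_add_cancel] at this

namespace IsMaximalSymmetricRegular

variable (hm : IsMaximalSymmetricRegular H s)
include hm

theorem cartan_mem (hne : s ≠ derivedAlgebra L) (t : H × ℂ × ℂ) : cartan H t ∈ s := by
  obtain ⟨hs, hsymm, htop⟩ := hm.prop
  by_cases h : supCartan hs = ⊤
  · exact absurd (eq_derivedAlgebra_of_le H (derivedAlgebra_le_of_supCartan_eq_top hs h) htop) hne
  · have h1 := hm.eq_of_le ⟨isRegular_of_cartan_mem (cartan_mem_supCartan hs), fun χ ↦ by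
      rw [rootsOf_supCartan hs]; exact hsymm χ, h⟩ (le_supCartan hs)
    exact h1 ▸ cartan_mem_supCartan hs t

theorem eq_of_le_subalgebra (hΨ : IsClosedSystem Ψ) (hne : Ψ ≠ realRoots H)
    (hle : s ≤ hΨ.subalgebra) : s = hΨ.subalgebra :=
  hm.eq_of_le ⟨isRegular_of_cartan_mem hΨ.cartan_mem_subalgebra, hΨ.isSymmetric_subalgebra,
    hΨ.subalgebra_ne_top hne⟩ hle

theorem realRootsOf_eq_of_le_subalgebra (hΨ : IsClosedSystem Ψ) (hne : Ψ ≠ realRoots H)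
    (hle : s ≤ hΨ.subalgebra) : realRootsOf H s = Ψ := by
  rw [hm.eq_of_le_subalgebra hΨ hne hle, hΨ.realRootsOf_subalgebra]

theorem isClosedSystem (hne : s ≠ derivedAlgebra L) : IsClosedSystem (realRootsOf H s) :=
  isClosedSystem_realRootsOf (hm.cartan_mem hne) hm.prop.2.1

theorem realRootsOf_ne (hne : s ≠ derivedAlgebra L) : realRootsOf H s ≠ realRoots H := fun h ↦
  hm.prop.2.2 (eq_top_of_realRoots_subset (hm.cartan_mem hne) h.ge)

theorem eq_subalgebra (hne : s ≠ derivedAlgebra L) : s = (hm.isClosedSystem hne).subalgebra :=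
  hm.eq_of_le_subalgebra _ (hm.realRootsOf_ne hne) <|
    (hm.isClosedSystem hne).le_subalgebra (hm.cartan_mem hne) subset_rfl
      fun _ _ hx ↦ mem_periodSpace_realRootsOf (hm.cartan_mem hne) hx

/-- For a full preimage every integer is a period, so the condition on imaginary root vectors is
automatic. -/
theorem realRootsOf_eq_translates (hne : s ≠ derivedAlgebra L) {R : Set (Module.Dual ℂ H)}
    (hR : IsClosedSystem (translates R)) {β : Module.Dual ℂ H} (hβ : IsRoot H β) (hβR : β ∉ R)
    (hle : realRootsOf H s ⊆ translates R) : realRootsOf H s = translates R :=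
  hm.realRootsOf_eq_of_le_subalgebra hR (translates_ne_realRoots hβ hβR) <|
    hR.le_subalgebra (hm.cartan_mem hne) hle fun r x _ ↦
      mem_periodSpace_of_forall (fun β _ ↦ isPeriod_translates R β r) x

theorem eq_realRootsOf_of_subset (hne : s ≠ derivedAlgebra L) (hs : (realRootsOf H s).Nonempty)
    (hΨ : IsClosedSystem Ψ) (hΨne : Ψ ≠ realRoots H) (hle : realRootsOf H s ⊆ Ψ) :
    realRootsOf H s = Ψ := by
  have hc := hm.isClosedSystem hne
  by_cases hR' : ∃ β, IsRoot H β ∧ β ∉ gradient Ψ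
  · obtain ⟨β, hβ, hβR⟩ := hR'
    have hsub := hle.trans hΨ.subset_translates_gradient
    refine hle.antisymm ?_
    rw [hm.realRootsOf_eq_translates hne hΨ.translates_gradient hβ hβR hsub]
    exact hΨ.subset_translates_gradient
  push Not at hR'
  by_cases hR : ∃ β, IsRoot H β ∧ β ∉ gradient (realRootsOf H s)
  · obtain ⟨β, hβ, hβR⟩ := hR
    have h1 := hm.realRootsOf_eq_translates hne hc.translates_gradient hβ hβR
      hc.subset_translates_gradient
    obtain ⟨χ, hχ⟩ := hs
    obtain ⟨α, r, -, -, rfl⟩ := hc.subset_realRoots hχ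
    have hα := hc.isRoot hχ
    rw [h1] at hle hχ
    -- The real roots of `s` fill the whole fibre over `α`, so every integer is a period of `Ψ` at
    -- `α`. It is then a period at every root, and `Ψ`, having no empty fibre, is all of `realRoots
    -- H`.
    have hper (t : ℤ) : IsPeriod Ψ α t := hΨ.isPeriod_of_mem (hle hχ)
      (hle (isPeriod_translates _ α t r hχ))
    refine absurd (hΨ.subset_realRoots.antisymm ?_) hΨne
    rintro _ ⟨γ, t, h2, h3, rfl⟩
    obtain ⟨u, hu⟩ := hR' γ ⟨h2, h3⟩
    have := hΨ.isPeriod_of_isPeriod hR' hα (hper (t - u)) ⟨h2, h3⟩ u hu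
    rwa [add_sub_cancel] at this
  push Not at hR
  refine hm.realRootsOf_eq_of_le_subalgebra hΨ hΨne
    (hΨ.le_subalgebra (hm.cartan_mem hne) hle fun r x hx ↦ ?_)
  by_cases hx0 : x = 0
  · rw [hx0]; exact zero_mem _
  -- Some root `β` sees `x`, and the fibre of `s` over `β` is nonempty, so `x ⊗ t ^ r` joins two
  -- elements of that fibre. Hence `r` is a period of `Ψ` at `β`, and so at every root.
  obtain ⟨β, hβ, hβx⟩ := IsRoot.exists_apply_ne_zero hx0
  obtain ⟨t, ht⟩ := hR β hβ
  have h1 := add_mem_realRootsOf (hm.cartan_mem hne) hx ht hβx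
  exact mem_periodSpace_of_forall (fun γ hγ ↦ hΨ.isPeriod_of_isPeriod hR' hβ
    (hΨ.isPeriod_of_mem (hle ht) (hle h1)) hγ) x

theorem isMaximalRealClosedSubrootSystem (hne : s ≠ derivedAlgebra L)
    (hs : (realRootsOf H s).Nonempty) :
    IsMaximalRealClosedSubrootSystem H (realRootsOf H s) := by
  have hc := hm.isClosedSystem hne
  exact ⟨⟨hc.isSubrootSystem hs, hc.isRealClosed, hm.realRootsOf_ne hne⟩,
    fun Φ ⟨h1, h2, h3⟩ hle ↦
      (hm.eq_realRootsOf_of_subset hne hs (h1.isClosedSystem h2) h3 hle).ge⟩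

theorem realRootsOf_nonempty (hne : s ≠ derivedAlgebra L) (hrank : 2 ≤ Module.finrank ℂ H) :
    (realRootsOf H s).Nonempty := by
  by_contra hs
  rw [Set.not_nonempty_iff_eq_empty] at hs
  obtain ⟨α, hα⟩ := IsRoot.exists_isRoot H
  obtain ⟨β, hβ, h1, h2⟩ := hα.exists_ne_and_ne_neg hrank
  have h3 := hm.realRootsOf_eq_translates hne (isClosedSystem_translates_pair hα) hβ
    (by simp [h1, h2]) (hs ▸ Set.empty_subset _)
  have h4 : affineWeight H α 0 ∈ realRootsOf H s :=
    h3 ▸ affineWeight_mem_translates.2 (Set.mem_insert _ _)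
  rw [hs] at h4
  exact h4

end IsMaximalSymmetricRegular

/-- The hypothesis `hmax` only tests subalgebras above `h.subalgebra`, which is weaker than
maximality of `Ψ`. This lets the lemma apply to the empty system in rank one. -/
theorem IsClosedSystem.isMaximalSymmetricRegular (h : IsClosedSystem Ψ) (hne : Ψ ≠ realRoots H)
    (hmax : ∀ s : LieSubalgebra ℂ (UntwistedAffine L), h.subalgebra ≤ s →
      IsClosedSystem (realRootsOf H s) → realRootsOf H s ≠ realRoots H → realRootsOf H s ⊆ Ψ) :
    IsMaximalSymmetricRegular H h.subalgebra := by
  refine ⟨⟨isRegular_of_cartan_mem h.cartan_mem_subalgebra, h.isSymmetric_subalgebra,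
    h.subalgebra_ne_top hne⟩, fun s ⟨_, hsymm, htop⟩ hle ↦ ?_⟩
  have hs (t : H × ℂ × ℂ) : cartan H t ∈ s := hle (h.cartan_mem_subalgebra t)
  have hsub : realRootsOf H s = Ψ := by
    refine (hmax s hle (isClosedSystem_realRootsOf hs hsymm)
      fun h1 ↦ htop (eq_top_of_realRoots_subset hs h1.ge)).antisymm ?_
    rw [← h.realRootsOf_subalgebra]
    rintro χ ⟨h1, h2, h3⟩
    exact ⟨h1, h2, ne_bot_of_le_ne_bot h3 (inf_le_inf_left _ hle)⟩
  exact h.le_subalgebra hs hsub.le fun r x hx ↦ hsub ▸ mem_periodSpace_realRootsOf hs hx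

theorem IsMaximalRealClosedSubrootSystem.exists_eq_realRootsOf
    (h : IsMaximalRealClosedSubrootSystem H Ψ) : ∃ s : LieSubalgebra ℂ (UntwistedAffine L),
      (IsMaximalSymmetricRegular H s ∧ s ≠ derivedAlgebra L) ∧ realRootsOf H s = Ψ := by
  obtain ⟨h1, h2, h3⟩ := h.prop
  have hc := h1.isClosedSystem h2
  refine ⟨hc.subalgebra, ⟨hc.isMaximalSymmetricRegular h3 fun s hle hs hne ↦ ?_,
    hc.subalgebra_ne_derivedAlgebra⟩, hc.realRootsOf_subalgebra⟩
  have hle' : Ψ ⊆ realRootsOf H s := by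
    rw [← hc.realRootsOf_subalgebra]
    rintro χ ⟨h1, h2, h3⟩
    exact ⟨h1, h2, ne_bot_of_le_ne_bot h3 (inf_le_inf_left _ hle)⟩
  exact h.le_of_ge ⟨hs.isSubrootSystem (h1.nonempty.mono hle'), hs.isRealClosed, hne⟩ hle'

theorem empty_ne_realRoots : (∅ : Set (CartanDual H)) ≠ realRoots H := fun h ↦ by
  obtain ⟨β, hβ⟩ := IsRoot.exists_isRoot H
  have h1 : affineWeight H β 0 ∈ realRoots H := mem_realRoots_iff.2 hβ
  rw [← h] at h1
  exact h1

theorem isMaximalSymmetricRegular_subalgebra_empty (hrank : Module.finrank ℂ H = 1) :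
    IsMaximalSymmetricRegular H (isClosedSystem_empty (H := H)).subalgebra := by
  refine isClosedSystem_empty.isMaximalSymmetricRegular empty_ne_realRoots fun s hle hs hne ↦ ?_
  intro χ hχ
  have hcartan (t : H × ℂ × ℂ) : cartan H t ∈ s :=
    hle (isClosedSystem_empty.cartan_mem_subalgebra t)
  refine absurd (hs.subset_realRoots.antisymm ?_) hne
  obtain ⟨α, r, -, -, rfl⟩ := hs.subset_realRoots hχ
  have hα := hs.isRoot hχ
  have hall (t : ℤ) : affineWeight H α t ∈ realRootsOf H s := by
    -- For the empty system all periods hold vacuously, so every `H ⊗ t ^ n` is in `s`. A single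
    -- real root is then moved to all its translates.
    have h1 : tensor (t - r) (hα.coroot : L) ∈ s := hle
      (isClosedSystem_empty.tensor_coe_mem_subalgebra.2
        (mem_periodSpace_of_forall (fun _ _ _ h ↦ h.elim) _))
    have := add_mem_realRootsOf hcartan h1 hχ (by rw [hα.apply_coroot]; exact two_ne_zero)
    rwa [add_sub_cancel] at this
  rintro _ ⟨β, t, h1, h2, rfl⟩
  rcases hα.eq_or_eq_neg_of_finrank_eq_one (β := β) ⟨h1, h2⟩ hrank with rfl | rfl
  · exact hall t
  · simpa using hs.affineWeight_neg_mem (hall (-t))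

variable (H) in
theorem injOn_realRootsOf : Set.InjOn (realRootsOf H)
    {s | IsMaximalSymmetricRegular H s ∧ s ≠ derivedAlgebra L} := by
  rintro s ⟨hs, hne⟩ s' ⟨hs', hne'⟩ h
  refine hs.eq_of_le hs'.prop ?_
  rw [hs'.eq_subalgebra hne']
  exact (hs'.isClosedSystem hne').le_subalgebra (hs.cartan_mem hne) h.le
    fun r x hx ↦ h ▸ mem_periodSpace_realRootsOf (hs.cartan_mem hne) hx

end

end UntwistedAffine

end

theorem mainTheorem7 (L : Type*) [LieRing L] [LieAlgebra ℂ L] [FiniteDimensional ℂ L]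
    [LieAlgebra.IsSimple ℂ L] (H : LieSubalgebra ℂ L) [H.IsCartanSubalgebra] :
    (2 ≤ Module.finrank ℂ H →
      Set.BijOn (UntwistedAffine.realRootsOf H)
        {s | UntwistedAffine.IsMaximalSymmetricRegular H s ∧ s ≠ UntwistedAffine.derivedAlgebra L}
        {Ψ | UntwistedAffine.IsMaximalRealClosedSubrootSystem H Ψ}) ∧
    (Module.finrank ℂ H = 1 →
      Set.BijOn (UntwistedAffine.realRootsOf H)
        {s | UntwistedAffine.IsMaximalSymmetricRegular H s ∧ s ≠ UntwistedAffine.derivedAlgebra L}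
        (insert ∅ {Ψ | UntwistedAffine.IsMaximalRealClosedSubrootSystem H Ψ})) := by
  refine ⟨fun hrank ↦ ⟨fun s ⟨hm, hne⟩ ↦ ?_, UntwistedAffine.injOn_realRootsOf H, fun Ψ hΨ ↦ ?_⟩,
    fun hrank ↦ ⟨fun s ⟨hm, hne⟩ ↦ ?_, UntwistedAffine.injOn_realRootsOf H, ?_⟩⟩
  · exact hm.isMaximalRealClosedSubrootSystem hne (hm.realRootsOf_nonempty hne hrank)
  · exact hΨ.exists_eq_realRootsOf
  · rcases (UntwistedAffine.realRootsOf H s).eq_empty_or_nonempty with h | h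
    · exact .inl h
    · exact .inr (hm.isMaximalRealClosedSubrootSystem hne h)
  · rintro Ψ (rfl | hΨ)
    · exact ⟨_, ⟨UntwistedAffine.isMaximalSymmetricRegular_subalgebra_empty hrank,
        UntwistedAffine.isClosedSystem_empty.subalgebra_ne_derivedAlgebra⟩,
        UntwistedAffine.isClosedSystem_empty.realRootsOf_subalgebra⟩
    · exact hΨ.exists_eq_realRootsOf
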